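/- Let $K,M,T$ be integers with $T\ge 1$. Let $\bar s_1,\dots,\bar s_K$ be independent random vectors in $\mathbb R^{MT}$, where $\bar s_k$ stacks $s_k^{(1)},\dots,s_k^{(M)}\in\mathbb R^T$ and is zero-mean Gaussian with known positive definite covariance matrix $\bar C_k$. Write $\bar P_k=\bar C_k^{-1}$, and let $C_k^{(m,n)},P_k^{(m,n)}\in\mathbb R^{T\times T}$ be the $(m,n)$-th blocks of $\bar C_k,\bar P_k$. Let $p_k(x)=(2\pi)^{-MT/2}|\det\bar C_k|^{-1/2}\exp(-\tfrac12x^{\mathsf T}\bar C_k^{-1}x)$, which is the density of $\bar s_k$. Define the score (row) vector $\varphi_k^{(m)}$ as the derivative of $-\log p_k$ with respect to the $m$-th component, evaluated at $\bar s_k$, and let $$\Gamma_k^{(m,n)}=E\big[\varphi_k^{(m)\mathsf T}\varphi_k^{(n)}\big],\qquad \mathcal K_{k\ell}[m,n]=\tfrac1T\operatorname{Tr}\big(\Gamma_k^{(n,m)}C_\ell^{(m,n)}\big).$$ Then $\varphi_k^{(m)}=\sum_{p}s_k^{(p)\mathsf T}P_k^{(p,m)}$, the products of entries of scores are integrable,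 and for all $k,\ell,m,n$ $$\Gamma_k^{(m,n)}=P_k^{(m,n)},\qquad \mathcal K_{k\ell}[m,n]=\tfrac1T\operatorname{Tr}\big(P_k^{(n,m)}C_\ell^{(m,n)}\big);$$ moreover every $M\times M$ matrix $\mathcal K_{k\ell}$ is positive definite. Let $A^{(1)},\dots,A^{(M)}\in\mathbb R^{K\times K}$ be invertible mixing matrices, let $X^{(m)}=A^{(m)}S^{(m)}$ be the observations, where the $k$-th row of $S^{(m)}$ is $s_k^{(m)\mathsf T}$, and let $\hat B^{(1)},\dots,\hat B^{(M)}$ be measurable functions of $(X^{(1)},\dots,X^{(M)})$ with values in $\mathbb R^{K\times K}$ (estimators of the demixing matrices). Fix $k\ne\ell$ and $m$ such that $\mathcal K_{k\ell}-\mathcal K_{\ell k}^{-1}$ is invertible (the pair is identifiable), assume that $(\hat B^{(m)}A^{(m)})_{kk}\ne0$ almost surely, and put $$\mathrm{ISR}_{k\ell}^{(m)}=E\left[\frac{|(\hat B^{(m)}A^{(m)})_{k\ell}|^2}{|(\hat B^{(m)}A^{(m)})_{kk}|^2}\right]\cdot\frac{E[s_\ell^{(m)\mathsf T}s_\ell^{(m)}]}{E[s_k^{(m)\mathsf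 T}s_k^{(m)}]}\in[0,\infty],$$ $$\beta_{k\ell}^{(m)}=\frac1T\,e_m^{\mathsf T}\big[\mathcal K_{k\ell}-\mathcal K_{\ell k}^{-1}\big]^{-1}e_m\cdot\frac{\operatorname{Tr}(C_\ell^{(m,m)})}{\operatorname{Tr}(C_k^{(m,m)})}.$$ (a) Suppose that the relative coefficient is locally unbiased at $A=(A^{(n)})_n$: the bias $$\tilde A\mapsto E_{\tilde A}\left[\frac{(\hat B^{(m)}A^{(m)})_{k\ell}}{(\hat B^{(m)}A^{(m)})_{kk}}\right]-\frac{((\tilde A^{(m)})^{-1}A^{(m)})_{k\ell}}{((\tilde A^{(m)})^{-1}A^{(m)})_{kk}},$$ where $E_{\tilde A}$ is the expectation when the observations are generated with mixing matrices $\tilde A$, vanishes at $\tilde A=A$ together with all its directional derivatives. Then $\mathrm{ISR}_{k\ell}^{(m)}\ge\beta_{k\ell}^{(m)}$. (b) Suppose instead that the estimator is equivariant: $\hat B^{(m)}(D^{(1)}X^{(1)},\dots,D^{(M)}X^{(M)})=\hat B^{(m)}(X^{(1)},\dots,X^{(M)})(D^{(m)})^{-1}$ for all data, all $m$ and all invertible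 $D^{(1)},\dots,D^{(M)}$. Then $$\big(1+2\max(0,-c)\big)\,\mathrm{ISR}_{k\ell}^{(m)}\ge\beta_{k\ell}^{(m)},\qquad c=\tfrac1T\,e_m^{\mathsf T}\mathcal K_{\ell k}^{-1}\big[\mathcal K_{k\ell}-\mathcal K_{\ell k}^{-1}\big]^{-1}e_m;$$ in particular $\mathrm{ISR}_{k\ell}^{(m)}\ge\beta_{k\ell}^{(m)}$ if $c\ge0$. -/

import Mathlib

open MeasureTheory ProbabilityTheory Matrix
open scoped ENNReal

noncomputable section

namespace IVA

/-- Values of a source component vector (SCV): the entry `(m, t)` is the value at time `t` of the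
component of the source that belongs to dataset `m`. -/
abbrev SCV (M T : ℕ) : Type := EuclideanSpace ℝ (Fin M × Fin T)

/-- Values of all `M` observed mixture matrices, each of size `K × T`: `X m i t`. -/
abbrev Data (K M T : ℕ) : Type := Fin M → Fin K → Fin T → ℝ

/-- The `(m, n)`-th `T × T` block of an `MT × MT` matrix. -/
def block {M T : ℕ} (C : Matrix (Fin M × Fin T) (Fin M × Fin T) ℝ) (m n : Fin M) :
    Matrix (Fin T) (Fin T) ℝ :=
  Matrix.of fun t u => C (m, t) (n, u)

/-- The joint law of the `K` SCVs: independent, zero-mean Gaussian with covariances `C k`. -/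
def sourceLaw {K M T : ℕ} (C : Fin K → Matrix (Fin M × Fin T) (Fin M × Fin T) ℝ) :
    Measure (Fin K → SCV M T) :=
  Measure.pi fun k => multivariateGaussian 0 (C k)

/-- The zero-mean Gaussian probability density with covariance `C`. -/
def density {M T : ℕ} (C : Matrix (Fin M × Fin T) (Fin M × Fin T) ℝ) (x : SCV M T) : ℝ :=
  (2 * Real.pi) ^ (-((M : ℝ) * T / 2)) * |C.det| ^ (-(1 / 2 : ℝ)) *
    Real.exp (-(1 / 2) * (x ⬝ᵥ C⁻¹ *ᵥ x))

/-- The score vector of the `m`-th component: the derivative of the negative log-density of the SCV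
with respect to its `m`-th component (a vector of `T` partial derivatives). -/
def score {M T : ℕ} (C : Matrix (Fin M × Fin T) (Fin M × Fin T) ℝ) (m : Fin M) (x : SCV M T) :
    Fin T → ℝ :=
  fun t => fderiv ℝ (fun y : SCV M T => -Real.log (density C y)) x (EuclideanSpace.single (m, t) 1)

/-- `Γ^{(m,n)} = E[φ^{(m)ᵀ} φ^{(n)}]`, the covariance matrix of the score row vectors. -/
def scoreCov {M T : ℕ} (C : Matrix (Fin M × Fin T) (Fin M × Fin T) ℝ) (m n : Fin M) :
    Matrix (Fin T) (Fin T) ℝ :=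
  Matrix.of fun t u => ∫ x, score C m x t * score C n x u ∂(multivariateGaussian 0 C)

/-- The `M × M` matrix `𝒦_{kl}`, with entries `(1/T) Tr(Γ_k^{(n,m)} C_l^{(m,n)})`. -/
def kappa {K M T : ℕ} (C : Fin K → Matrix (Fin M × Fin T) (Fin M × Fin T) ℝ) (k l : Fin K) :
    Matrix (Fin M) (Fin M) ℝ :=
  Matrix.of fun m n => (1 / (T : ℝ)) * (scoreCov (C k) n m * block (C l) m n).trace

/-- The observations `X^{(m)} = A^{(m)} S^{(m)}`, where the `k`-th row of `S^{(m)}` is the `m`-th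
component of the `k`-th SCV. -/
def mix {K M T : ℕ} (A : Fin M → Matrix (Fin K) (Fin K) ℝ) (s : Fin K → SCV M T) : Data K M T :=
  fun m i t => ∑ j, A m i j * s j (m, t)

/-- The relative interference coefficient `(B A)_{kl} / (B A)_{kk}`. -/
def relCoef {K : ℕ} (B A : Matrix (Fin K) (Fin K) ℝ) (k l : Fin K) : ℝ :=
  (B * A) k l / (B * A) k k

/-- `E[s_k^{(m)ᵀ} s_k^{(m)}]`. -/
def energy {K M T : ℕ} (C : Fin K → Matrix (Fin M × Fin T) (Fin M × Fin T) ℝ) (k : Fin K)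
    (m : Fin M) : ℝ :=
  ∫ s, ∑ t, s k (m, t) * s k (m, t) ∂(sourceLaw C)

/-- The interference-to-source ratio `ISR_{kl}^{(m)}` of the estimator `Bhat` of the demixing
matrices, when the mixing matrices are `A`. The value `∞` is allowed. -/
def ISR {K M T : ℕ} (C : Fin K → Matrix (Fin M × Fin T) (Fin M × Fin T) ℝ)
    (A : Fin M → Matrix (Fin K) (Fin K) ℝ)
    (Bhat : Data K M T → Fin M → Matrix (Fin K) (Fin K) ℝ) (k l : Fin K) (m : Fin M) : ℝ≥0∞ :=
  (∫⁻ s, ENNReal.ofReal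
      (|(Bhat (mix A s) m * A m) k l| ^ 2 / |(Bhat (mix A s) m * A m) k k| ^ 2) ∂(sourceLaw C)) *
    ENNReal.ofReal (energy C l m / energy C k m)

/-- With reference mixing matrices `A₀`, the coefficient `(B̂ A₀)_{kl} / (B̂ A₀)_{kk}` is an estimator
of `(A⁻¹ A₀)_{kl} / (A⁻¹ A₀)_{kk}`; this is its bias when the observations are generated with the
mixing matrices `A`. -/
def bias {K M T : ℕ} (C : Fin K → Matrix (Fin M × Fin T) (Fin M × Fin T) ℝ)
    (Bhat : Data K M T → Fin M → Matrix (Fin K) (Fin K) ℝ) (k l : Fin K) (m : Fin M)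
    (A₀ A : Fin M → Matrix (Fin K) (Fin K) ℝ) : ℝ :=
  (∫ s, relCoef (Bhat (mix A s) m) (A₀ m) k l ∂(sourceLaw C)) - relCoef (A m)⁻¹ (A₀ m) k l

/-- Local unbiasedness at `A₀`: the bias vanishes at `A₀`, together with all its directional
derivatives in the mixing matrices. An estimator whose bias vanishes for all mixing matrices near
`A₀` has this property. -/
def LocallyUnbiased {K M T : ℕ} (C : Fin K → Matrix (Fin M × Fin T) (Fin M × Fin T) ℝ)
    (Bhat : Data K M T → Fin M → Matrix (Fin K) (Fin K) ℝ) (k l : Fin K) (m : Fin M)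
    (A₀ : Fin M → Matrix (Fin K) (Fin K) ℝ) : Prop :=
  bias C Bhat k l m A₀ A₀ = 0 ∧
    ∀ H : Fin M → Matrix (Fin K) (Fin K) ℝ,
      HasDerivAt (fun ε : ℝ => bias C Bhat k l m A₀ (A₀ + ε • H)) 0 0

/-- Equivariance: multiplying the observations of each dataset `m` from the left by an invertible
matrix `D m` multiplies the estimated demixing matrix from the right by `(D m)⁻¹`. -/
def Equivariant {K M T : ℕ} (Bhat : Data K M T → Fin M → Matrix (Fin K) (Fin K) ℝ) : Prop :=
  ∀ D : Fin M → Matrix (Fin K) (Fin K) ℝ, (∀ n, IsUnit (D n)) →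
    ∀ (X : Data K M T) (m : Fin M),
      Bhat (fun n i t => ∑ j, D n i j * X n j t) m = Bhat X m * (D m)⁻¹

/-- The right-hand side of the bound on `ISR_{kl}^{(m)}`:
`(1/T) e_mᵀ [𝒦_{kl} - 𝒦_{lk}⁻¹]⁻¹ e_m · Tr(C_l^{(m,m)}) / Tr(C_k^{(m,m)})`. -/
def iCRLB {K M T : ℕ} (C : Fin K → Matrix (Fin M × Fin T) (Fin M × Fin T) ℝ) (k l : Fin K)
    (m : Fin M) : ℝ :=
  (1 / (T : ℝ)) *
    (Pi.single m 1 ⬝ᵥ (kappa C k l - (kappa C l k)⁻¹)⁻¹ *ᵥ Pi.single m 1) *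
    ((block (C l) m m).trace / (block (C k) m m).trace)

/-- The number `(1/T) e_mᵀ 𝒦_{lk}⁻¹ [𝒦_{kl} - 𝒦_{lk}⁻¹]⁻¹ e_m`. -/
def crossTerm {K M T : ℕ} (C : Fin K → Matrix (Fin M × Fin T) (Fin M × Fin T) ℝ) (k l : Fin K)
    (m : Fin M) : ℝ :=
  (1 / (T : ℝ)) *
    (Pi.single m 1 ⬝ᵥ ((kappa C l k)⁻¹ * (kappa C k l - (kappa C l k)⁻¹)⁻¹) *ᵥ Pi.single m 1)

end IVA

end

/-! This is a Cramér-Rao argument along two families of shears of the sources. Replacing `s k` by `s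
k + ε α s l`, with the `m`-th component of `s l` scaled by `α m`, is a translation by a fixed vector
once `s l` is frozen. By Cameron-Martin it multiplies the law by an explicit exponential, so the
derivative at `ε = 0` of the mean of `h` after the shear is `E[crossStat * h]`
(`hasDerivAt_integral_comp_shear`). On the observations the same shear is a column operation on the
mixing matrices (`mix_shear`).

Let `r` be the relative coefficient and `v = E[r²]`. The `(k, l)` shear along `α` gives `E[crossStat
* r] = -α m` under either hypothesis on the estimator. The `(l, k)` shear along `β` gives `β m * w`.
Local unbiasedness yields `w = 0`. Equivariance turns `r` into `r / (1 - ε β r)`, whose derivative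
is `β r²`, hence `w = v`.

The sum of the two statistics has second moment `T (αᵀ 𝒦_{kl} α + βᵀ 𝒦_{lk} β + 2 αᵀ β)`
(`integral_sq_crossStat_add`). Cauchy-Schwarz with `G = 𝒦_{kl} - 𝒦_{lk}⁻¹`, `α = G⁻¹ e_m` and `β =
-𝒦_{lk}⁻¹ α` gives `(b + c w)² ≤ b v`, where `b = α m / T` and `c = -β m / T` is the cross term.
Both bounds follow by elementary algebra; an infinite ISR is trivial. -/

namespace IVA

/-! ### Gaussian densities, scores, and positivity of the matrices `kappa`. -/

section Gaussian

section Density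

variable {E : Type*} [NormedAddCommGroup E] [InnerProductSpace ℝ E] [FiniteDimensional ℝ E]
  [MeasurableSpace E] [BorelSpace E]

lemma integrable_exp_neg_half_norm_sq :
    Integrable (fun x : E => Real.exp (-‖x‖ ^ 2 / 2)) := by
  have h := (GaussianFourier.integrable_cexp_neg_mul_sq_norm_add (V := E) (b := 1 / 2)
    (by norm_num) 0 0).norm
  refine h.congr (.of_forall fun x => ?_)
  simp only [Complex.norm_exp]
  congr 1
  have : -(1 / 2 : ℂ) * (‖x‖ : ℂ) ^ 2 + 0 * ((inner ℝ (0 : E) x : ℝ) : ℂ) =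
      ((-‖x‖ ^ 2 / 2 : ℝ) : ℂ) := by
    push_cast; ring
  rw [this, Complex.ofReal_re]

/-- Both sides are finite measures, so it suffices that their characteristic functions agree; that
of the right side is the Fourier transform of a Gaussian. -/
theorem stdGaussian_eq_withDensity :
    stdGaussian E = volume.withDensity fun x => ENNReal.ofReal
      ((2 * Real.pi) ^ (-((Module.finrank ℝ E : ℝ) / 2)) * Real.exp (-‖x‖ ^ 2 / 2)) := by
  set c : ℝ := (2 * Real.pi) ^ (-((Module.finrank ℝ E : ℝ) / 2)) with hc
  have hc0 : 0 ≤ c := by positivity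
  have hint := (integrable_exp_neg_half_norm_sq (E := E)).const_mul c
  have : IsFiniteMeasure (volume.withDensity fun x : E =>
      ENNReal.ofReal (c * Real.exp (-‖x‖ ^ 2 / 2))) :=
    isFiniteMeasure_withDensity_ofReal hint.2
  refine Measure.ext_of_charFun (funext fun t => ?_)
  rw [charFun_stdGaussian, charFun_apply,
    integral_withDensity_eq_integral_toReal_smul (by fun_prop) (by simp)]
  have h1 : ∀ x : E, (ENNReal.ofReal (c * Real.exp (-‖x‖ ^ 2 / 2))).toReal •
      Complex.exp ((inner ℝ x t : ℝ) * Complex.I) =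
      (c : ℂ) * Complex.exp (-(1 / 2 : ℂ) * (‖x‖ : ℂ) ^ 2 +
        Complex.I * ((inner ℝ t x : ℝ) : ℂ)) := by
    intro x
    rw [ENNReal.toReal_ofReal (by positivity), Complex.exp_add, Complex.real_smul,
      real_inner_comm]
    push_cast
    rw [mul_assoc]
    congr 3
    · ring
    · ring_nf
  simp_rw [h1]
  rw [integral_const_mul, GaussianFourier.integral_cexp_neg_mul_sq_norm_add (by norm_num), hc,
    ← mul_assoc]
  have h2 : ((Real.pi : ℂ) / (1 / 2)) = ((2 * Real.pi : ℝ) : ℂ) := by push_cast; ring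
  rw [h2, Complex.ofReal_cpow (by positivity), ← Complex.cpow_add _ _ (by
    exact_mod_cast (by positivity : (2 * Real.pi) ≠ 0))]
  push_cast
  rw [neg_add_cancel, Complex.cpow_zero, one_mul, Complex.I_sq]
  congr 1
  ring

lemma map_withDensity_comp {α β : Type*} [MeasurableSpace α] [MeasurableSpace β] (μ : Measure α)
    {e : α → β} (he : Measurable e) {g : β → ℝ≥0∞} (hg : Measurable g) :
    (μ.withDensity fun x => g (e x)).map e = (μ.map e).withDensity g := by
  ext s hs
  rw [Measure.map_apply he hs, withDensity_apply _ (he hs), withDensity_apply _ hs,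
    setLIntegral_map hs hg he]

end Density

variable {M T : ℕ} {C : Matrix (Fin M × Fin T) (Fin M × Fin T) ℝ}

lemma measurable_density : Measurable (density C) := by
  unfold density
  simp only [dotProduct, mulVec]
  fun_prop

open scoped MatrixOrder in
-- The measure is the image of the standard Gaussian under `S = √C`. Since `S C⁻¹ S = 1`, the
-- standard density at `x` is `|det S|` times `density C (S x)`, and the linear change of variables
-- cancels this factor.
theorem multivariateGaussian_eq_withDensity (hC : C.PosDef) :
    multivariateGaussian 0 C =
      volume.withDensity (fun x => ENNReal.ofReal (density C x)) := by
  set S := CFC.sqrt C with hS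
  have hSS : S * S = C := CFC.sqrt_mul_sqrt_self _ hC.posSemidef.nonneg
  have hST : Sᵀ = S := by
    have : Sᴴ = S := (CFC.sqrt_nonneg C).isSelfAdjoint
    simpa using this
  set f : SCV M T →L[ℝ] SCV M T := toEuclideanCLM (𝕜 := ℝ) S with hf
  have hdetC := hC.det_pos
  have hdet : S.det * S.det = C.det := by rw [← det_mul, hSS]
  have hdetS : S.det ≠ 0 := fun h => by rw [h] at hdet; simp at hdet; exact hdetC.ne hdet
  have hdetf : LinearMap.det (f : SCV M T →ₗ[ℝ] SCV M T) = S.det := by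
    rw [hf, coe_toEuclideanCLM_eq_toEuclideanLin, toEuclideanLin_eq_toLin_orthonormal,
      LinearMap.det_toLin]
  have hunit : IsUnit S.det := hdetS.isUnit
  have hSCS : S * C⁻¹ * S = 1 := by
    rw [← hSS, Matrix.mul_inv_rev, ← Matrix.mul_assoc, Matrix.mul_nonsing_inv _ hunit,
      Matrix.one_mul, Matrix.nonsing_inv_mul _ hunit]
  have habs : |S.det| = C.det ^ (1 / 2 : ℝ) := by
    rw [← hdet, ← sq, ← Real.sqrt_eq_rpow, Real.sqrt_sq_eq_abs]
  have hpt : ∀ x : SCV M T, ENNReal.ofReal ((2 * Real.pi) ^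
      (-((Module.finrank ℝ (SCV M T) : ℝ) / 2)) * Real.exp (-‖x‖ ^ 2 / 2)) =
      ENNReal.ofReal |S.det| * ENNReal.ofReal (density C (f x)) := by
    intro x
    rw [← ENNReal.ofReal_mul (abs_nonneg _)]
    congr 1
    have hq : (f x) ⬝ᵥ C⁻¹ *ᵥ (f x) = ‖x‖ ^ 2 := by
      rw [hf, ofLp_toEuclideanCLM, EuclideanSpace.real_norm_sq_eq]
      have : S *ᵥ x.ofLp = x.ofLp ᵥ* S := by rw [← vecMul_transpose, hST]
      nth_rw 1 [this]
      rw [← dotProduct_mulVec, mulVec_mulVec, mulVec_mulVec, hSCS, one_mulVec]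
      simp [dotProduct, sq]
    unfold density
    rw [hq, abs_of_pos hdetC, habs]
    have h1 : C.det ^ (1 / 2 : ℝ) * C.det ^ (-(1 / 2) : ℝ) = 1 := by
      rw [← Real.rpow_add hdetC]; simp
    have h2 : (Module.finrank ℝ (SCV M T) : ℝ) = M * T := by simp
    rw [h2]
    calc _ = (2 * Real.pi) ^ (-((M : ℝ) * T / 2)) *
          (C.det ^ (1 / 2 : ℝ) * C.det ^ (-(1 / 2) : ℝ)) * Real.exp (-(1 / 2) * ‖x‖ ^ 2) := by
            rw [h1, mul_one]; congr 2; ring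
      _ = _ := by ring
  have hm : Measurable fun y : SCV M T => ENNReal.ofReal (density C y) :=
    measurable_density.ennreal_ofReal
  have hmap : multivariateGaussian 0 C = (stdGaussian (SCV M T)).map f := by
    simp [multivariateGaussian, hf, hS]
  rw [hmap, stdGaussian_eq_withDensity]
  simp_rw [hpt]
  rw [map_withDensity_comp volume f.measurable (hm.const_mul (ENNReal.ofReal |S.det|))]
  have hv := Measure.map_linearMap_addHaar_eq_smul_addHaar (volume : Measure (SCV M T))
    (f := (f : SCV M T →ₗ[ℝ] SCV M T)) (by rw [hdetf]; exact hdetS)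
  rw [hdetf] at hv
  have hv' : Measure.map f volume = ENNReal.ofReal |S.det⁻¹| • (volume : Measure (SCV M T)) := hv
  rw [hv', withDensity_smul_measure]
  have : (fun y : SCV M T => ENNReal.ofReal |S.det| * ENNReal.ofReal (density C y)) =
      ENNReal.ofReal |S.det| • fun y => ENNReal.ofReal (density C y) := rfl
  rw [this, withDensity_smul _ hm, smul_smul, ← ENNReal.ofReal_mul (abs_nonneg _), ← abs_mul,
    inv_mul_cancel₀ hdetS]
  simp

lemma neg_log_density (hC : C.PosDef) (x : SCV M T) :
    -Real.log (density C x) = -Real.log ((2 * Real.pi) ^ (-((M : ℝ) * T / 2)) *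
      |C.det| ^ (-(1 / 2 : ℝ))) + 1 / 2 * (x ⬝ᵥ C⁻¹ *ᵥ x) := by
  have hdetC := hC.det_pos
  have : 0 < |C.det| := abs_pos.2 hdetC.ne'
  unfold density
  rw [Real.log_mul (by positivity) (Real.exp_ne_zero _), Real.log_exp]
  ring

lemma inv_apply_comm (hC : C.PosDef) (i j : Fin M × Fin T) : C⁻¹ i j = C⁻¹ j i := by
  have : (C⁻¹)ᵀ = C⁻¹ := by simpa using hC.inv.isHermitian.eq
  exact congrFun (congrFun this j) i

lemma apply_comm (hC : C.PosDef) (i j : Fin M × Fin T) : C i j = C j i := by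
  have : Cᵀ = C := by simpa using hC.isHermitian.eq
  exact congrFun (congrFun this j) i

/-- The negative log-density is a constant plus half the quadratic form of `C⁻¹`; symmetry of `C⁻¹`
merges the two halves of the product rule. -/
lemma score_apply (hC : C.PosDef) (m : Fin M) (x : SCV M T) (t : Fin T) :
    score C m x t = ∑ i, C⁻¹ (m, t) i * x i := by
  set v : SCV M T := EuclideanSpace.single (m, t) 1 with hv
  have hproj : ∀ i, HasFDerivAt (fun y : SCV M T => y i)
      (EuclideanSpace.proj i : SCV M T →L[ℝ] ℝ) x :=
    fun i => (EuclideanSpace.proj i : SCV M T →L[ℝ] ℝ).hasFDerivAt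
  have hq := (HasFDerivAt.fun_sum (u := Finset.univ) fun i _ =>
    (hproj i).fun_mul (HasFDerivAt.fun_sum (u := Finset.univ) fun j _ =>
      (hproj j).const_mul (C⁻¹ i j)))
  have hd := (hq.const_mul (1 / 2 : ℝ)).const_add (-Real.log ((2 * Real.pi) ^
    (-((M : ℝ) * T / 2)) * |C.det| ^ (-(1 / 2 : ℝ))))
  have hfun : (fun y : SCV M T => -Real.log (density C y)) = fun y =>
      -Real.log ((2 * Real.pi) ^ (-((M : ℝ) * T / 2)) * |C.det| ^ (-(1 / 2 : ℝ))) +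
        1 / 2 * ∑ i, y i * ∑ j, C⁻¹ i j * y j := by
    funext y; rw [neg_log_density hC]; simp only [dotProduct, mulVec]
  unfold score
  rw [hfun, hd.fderiv]
  simp only [_root_.smul_apply, _root_.sum_apply,
    _root_.add_apply, EuclideanSpace.coe_proj, PiLp.single_apply, smul_eq_mul,
    mul_ite, mul_one, mul_zero, Finset.sum_ite_eq', Finset.mem_univ, if_true,
    Finset.sum_add_distrib]
  have : ∑ i, x i * C⁻¹ i (m, t) = ∑ i, C⁻¹ (m, t) i * x i :=
    Finset.sum_congr rfl fun i _ => by rw [inv_apply_comm hC i, mul_comm]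
  rw [this]
  ring

lemma score_eq_sum_vecMul (hC : C.PosDef) (m : Fin M) (x : SCV M T) :
    score C m x = ∑ p, (fun t => x (p, t)) ᵥ* block C⁻¹ p m := by
  ext t
  rw [score_apply hC, Finset.sum_apply, Fintype.sum_prod_type]
  refine Finset.sum_congr rfl fun p _ => ?_
  simp only [vecMul, dotProduct, block, of_apply]
  exact Finset.sum_congr rfl fun u _ => by rw [inv_apply_comm hC (m, t), mul_comm]

section Moments

variable {ι : Type*} [Fintype ι] [DecidableEq ι] {S : Matrix ι ι ℝ}

lemma memLp_eval_multivariateGaussian (i : ι) :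
    MemLp (fun x : EuclideanSpace ℝ ι => x i) 2 (multivariateGaussian 0 S) :=
  IsGaussian.memLp_dual _ (EuclideanSpace.proj i : EuclideanSpace ℝ ι →L[ℝ] ℝ) 2 (by simp)

lemma integral_eval_multivariateGaussian (i : ι) :
    ∫ x : EuclideanSpace ℝ ι, x i ∂(multivariateGaussian 0 S) = 0 := by
  have := IsGaussian.integral_dual (μ := multivariateGaussian (0 : EuclideanSpace ℝ ι) S)
    (EuclideanSpace.proj i : EuclideanSpace ℝ ι →L[ℝ] ℝ)
  simpa using this

lemma integral_eval_mul_eval_multivariateGaussian (hS : S.PosSemidef) (i j : ι) :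
    ∫ x : EuclideanSpace ℝ ι, x i * x j ∂(multivariateGaussian 0 S) = S i j := by
  have h := covariance_eval_multivariateGaussian (μ := (0 : EuclideanSpace ℝ ι)) hS i j
  rw [covariance_eq_sub (memLp_eval_multivariateGaussian i)
    (memLp_eval_multivariateGaussian j)] at h
  simpa [integral_eval_multivariateGaussian] using h

lemma integrable_eval_mul_eval_multivariateGaussian (i j : ι) :
    Integrable (fun x : EuclideanSpace ℝ ι => x i * x j) (multivariateGaussian 0 S) :=
  (memLp_eval_multivariateGaussian i).integrable_mul (memLp_eval_multivariateGaussian j)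

end Moments

lemma integrable_score_mul_score (hC : C.PosDef) (m n : Fin M) (t u : Fin T) :
    Integrable (fun x => score C m x t * score C n x u) (multivariateGaussian 0 C) := by
  simp_rw [score_apply hC, Finset.sum_mul_sum]
  refine integrable_finsetSum _ fun i _ => integrable_finsetSum _ fun j _ => ?_
  refine ((integrable_eval_mul_eval_multivariateGaussian i j).const_mul
    (C⁻¹ (m, t) i * C⁻¹ (n, u) j)).congr (.of_forall fun x => ?_)
  simp only
  ring

/-- The full score is `C⁻¹ x`, so its covariance is `C⁻¹ C C⁻¹ = C⁻¹`. -/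
lemma scoreCov_eq_block (hC : C.PosDef) (m n : Fin M) : scoreCov C m n = block C⁻¹ m n := by
  ext t u
  simp only [scoreCov, block, of_apply]
  have h : ∀ x : SCV M T, score C m x t * score C n x u =
      ∑ i, ∑ j, (C⁻¹ (m, t) i * C⁻¹ (n, u) j) * (x i * x j) := fun x => by
    simp_rw [score_apply hC, Finset.sum_mul_sum]
    exact Finset.sum_congr rfl fun i _ => Finset.sum_congr rfl fun j _ => by ring
  have hi : ∀ i j, Integrable (fun x : SCV M T => (C⁻¹ (m, t) i * C⁻¹ (n, u) j) * (x i * x j))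
      (multivariateGaussian 0 C) := fun i j =>
    (integrable_eval_mul_eval_multivariateGaussian i j).const_mul _
  simp_rw [h]
  rw [integral_finsetSum _ fun i _ => integrable_finsetSum _ fun j _ => hi i j]
  simp_rw [integral_finsetSum _ fun j _ => hi _ j, integral_const_mul,
    integral_eval_mul_eval_multivariateGaussian hC.posSemidef]
  have : (C⁻¹ * C * C⁻¹) (m, t) (n, u) = C⁻¹ (m, t) (n, u) := by
    rw [Matrix.nonsing_inv_mul _ hC.det_pos.ne'.isUnit, Matrix.one_mul]
  rw [← this, Matrix.mul_assoc]
  simp only [Matrix.mul_apply, Finset.mul_sum]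
  exact Finset.sum_congr rfl fun i _ => Finset.sum_congr rfl fun j _ => by
    rw [inv_apply_comm hC (n, u)]; ring

variable {K : ℕ} {𝒞 : Fin K → Matrix (Fin M × Fin T) (Fin M × Fin T) ℝ}

lemma kappa_eq_trace (hC : ∀ k, (𝒞 k).PosDef) (k l : Fin K) (m n : Fin M) :
    kappa 𝒞 k l m n = (1 / (T : ℝ)) * (block (𝒞 k)⁻¹ n m * block (𝒞 l) m n).trace := by
  simp only [kappa, of_apply, scoreCov_eq_block (hC k)]

lemma kappa_eq_sum (hC : ∀ k, (𝒞 k).PosDef) (k l : Fin K) (m n : Fin M) :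
    kappa 𝒞 k l m n = (1 / (T : ℝ)) *
      ∑ t, ∑ u, (𝒞 k)⁻¹ (m, t) (n, u) * 𝒞 l (m, t) (n, u) := by
  rw [kappa_eq_trace hC, trace]
  simp only [diag_apply, Matrix.mul_apply, block, of_apply]
  rw [Finset.sum_comm]
  simp_rw [inv_apply_comm (hC k) (n, _)]

/-- This exhibits `T • kappa` as the Hadamard product of `(𝒞 k)⁻¹` and `𝒞 l`, restricted to vectors
that are constant in time. -/
lemma mul_dotProduct_kappa (hT : 0 < T) (hC : ∀ k, (𝒞 k).PosDef) (k l : Fin K)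
    (x y : Fin M → ℝ) :
    T * (x ⬝ᵥ kappa 𝒞 k l *ᵥ y) =
      ∑ i, ∑ j, x i.1 * ((𝒞 k)⁻¹ i j * 𝒞 l i j) * y j.1 := by
  have hT' : (T : ℝ) ≠ 0 := by positivity
  simp only [dotProduct, mulVec, kappa_eq_sum hC, Fintype.sum_prod_type, Finset.mul_sum,
    Finset.sum_mul]
  refine Finset.sum_congr rfl fun m _ => ?_
  rw [Finset.sum_comm (s := Finset.univ (α := Fin T))]
  refine Finset.sum_congr rfl fun n _ => Finset.sum_congr rfl fun t _ =>
    Finset.sum_congr rfl fun u _ => ?_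
  field_simp

theorem posDef_kappa (hT : 0 < T) (hC : ∀ k, (𝒞 k).PosDef) (k l : Fin K) :
    (kappa 𝒞 k l).PosDef := by
  have hT' : (0 : ℝ) < T := by exact_mod_cast hT
  refine PosDef.of_dotProduct_mulVec_pos ?_ fun x hx => ?_
  · ext m n
    simp only [conjTranspose_apply, star_trivial, kappa_eq_sum hC]
    rw [Finset.sum_comm]
    simp_rw [inv_apply_comm (hC k) (n, _), apply_comm (hC l) (n, _)]
  -- Schur product theorem. The lift `v` of `x` is nonzero because there is at least one time index.
  · have hH := (hC k).inv.hadamard (hC l)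
    set v : Fin M × Fin T → ℝ := fun i => x i.1 with hv
    have hv0 : v ≠ 0 := by
      obtain ⟨m, hm⟩ := Function.ne_iff.1 hx
      exact Function.ne_iff.2 ⟨(m, ⟨0, hT⟩), hm⟩
    have := hH.dotProduct_mulVec_pos hv0
    refine (mul_pos_iff_of_pos_left hT').1 ?_
    rw [star_trivial, mul_dotProduct_kappa hT hC]
    refine this.trans_eq ?_
    simp only [star_trivial, dotProduct, mulVec, hadamard_apply, Finset.mul_sum, hv, mul_assoc]

end Gaussian

/-! ### Shears of the sources and the derivative of expectations along them. -/

section Shear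

variable {K M T : ℕ}

section Shift

variable {C : Matrix (Fin M × Fin T) (Fin M × Fin T) ℝ}

lemma inner_inv_comm (hC : C.PosDef) (x y : SCV M T) :
    inner ℝ x (toEuclideanCLM (𝕜 := ℝ) C⁻¹ y) = inner ℝ y (toEuclideanCLM (𝕜 := ℝ) C⁻¹ x) := by
  have hT : (C⁻¹)ᵀ = C⁻¹ := by simpa using hC.inv.isHermitian.eq
  rw [inner_toEuclideanCLM, inner_toEuclideanCLM, dotProduct_mulVec, ← mulVec_transpose, hT,
    dotProduct_comm]

lemma inner_inv_nonneg (hC : C.PosDef) (x : SCV M T) :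
    0 ≤ inner ℝ x (toEuclideanCLM (𝕜 := ℝ) C⁻¹ x) := by
  rw [inner_toEuclideanCLM]
  simpa using hC.inv.posSemidef.dotProduct_mulVec_nonneg x.ofLp

lemma density_sub (hC : C.PosDef) (x v : SCV M T) :
    density C (x - v) = density C x * Real.exp (inner ℝ x (toEuclideanCLM (𝕜 := ℝ) C⁻¹ v) -
      1 / 2 * inner ℝ v (toEuclideanCLM (𝕜 := ℝ) C⁻¹ v)) := by
  have h : ∀ y : SCV M T, y ⬝ᵥ C⁻¹ *ᵥ y = inner ℝ y (toEuclideanCLM (𝕜 := ℝ) C⁻¹ y) :=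
    fun y => (inner_toEuclideanCLM _ _ _).symm
  unfold density
  rw [h, h, mul_assoc _ (Real.exp _) (Real.exp _), ← Real.exp_add]
  congr 2
  rw [map_sub, inner_sub_left, inner_sub_right, inner_sub_right, inner_inv_comm hC v x]
  ring

/-- The Cameron-Martin formula for a nondegenerate Gaussian measure on a Euclidean space. -/
theorem lintegral_add_multivariateGaussian (hC : C.PosDef) (v : SCV M T) {g : SCV M T → ℝ≥0∞}
    (hg : Measurable g) :
    ∫⁻ x, g (x + v) ∂(multivariateGaussian 0 C) =
      ∫⁻ x, ENNReal.ofReal (Real.exp (inner ℝ x (toEuclideanCLM (𝕜 := ℝ) C⁻¹ v) -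
        1 / 2 * inner ℝ v (toEuclideanCLM (𝕜 := ℝ) C⁻¹ v))) * g x
        ∂(multivariateGaussian 0 C) := by
  have hm : Measurable fun y : SCV M T => ENNReal.ofReal (density C y) :=
    measurable_density.ennreal_ofReal
  rw [multivariateGaussian_eq_withDensity hC,
    lintegral_withDensity_eq_lintegral_mul _ hm (by fun_prop),
    lintegral_withDensity_eq_lintegral_mul _ hm (by fun_prop),
    ← lintegral_sub_right_eq_self _ v]
  refine lintegral_congr fun x => ?_
  have hd : 0 ≤ density C x := by unfold density; positivity
  simp only [Pi.mul_apply, sub_add_cancel]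
  rw [density_sub hC, ENNReal.ofReal_mul hd, mul_assoc]

end Shift

/-- Adding `L (s l)` to the `k`-th component of `s`. -/
def shear (k l : Fin K) (L : SCV M T →L[ℝ] SCV M T) (s : Fin K → SCV M T) : Fin K → SCV M T :=
  Function.update s k (s k + L (s l))

lemma measurable_shear (k l : Fin K) (L : SCV M T →L[ℝ] SCV M T) : Measurable (shear k l L) := by
  unfold shear
  refine measurable_pi_iff.2 fun j => ?_
  rcases eq_or_ne j k with rfl | h
  · simp only [Function.update_self]; fun_prop
  · simp only [Function.update_of_ne h]; fun_prop

variable {C : Fin K → Matrix (Fin M × Fin T) (Fin M × Fin T) ℝ}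

instance : IsProbabilityMeasure (sourceLaw C) := by unfold sourceLaw; infer_instance

/-- Joint Gaussianity makes Fernique's theorem available for the norm of the whole source tuple. -/
instance : IsGaussian (sourceLaw C) := by
  have h := iIndepFun.hasGaussianLaw (P := sourceLaw C) (X := fun k s => s k)
    (fun k => ⟨by
      rw [sourceLaw, (measurePreserving_eval (fun k => multivariateGaussian 0 (C k)) k).map_eq]
      infer_instance⟩)
    (iIndepFun_pi (X := fun _ => id) fun _ => aemeasurable_id)
  have := h.isGaussian_map
  simpa using this

/-- The bilinear statistic `s_kᵀ C_k⁻¹ L s_l`. -/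
noncomputable def crossStat (C : Fin K → Matrix (Fin M × Fin T) (Fin M × Fin T) ℝ) (k l : Fin K)
    (L : SCV M T →L[ℝ] SCV M T) (s : Fin K → SCV M T) : ℝ :=
  inner ℝ (s k) (toEuclideanCLM (𝕜 := ℝ) (C k)⁻¹ (L (s l)))

/-- The quadratic statistic `(L s_l)ᵀ C_k⁻¹ (L s_l)`. -/
noncomputable def selfStat (C : Fin K → Matrix (Fin M × Fin T) (Fin M × Fin T) ℝ) (k l : Fin K)
    (L : SCV M T →L[ℝ] SCV M T) (s : Fin K → SCV M T) : ℝ :=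
  inner ℝ (L (s l)) (toEuclideanCLM (𝕜 := ℝ) (C k)⁻¹ (L (s l)))

lemma measurable_crossStat (k l : Fin K) (L : SCV M T →L[ℝ] SCV M T) :
    Measurable (crossStat C k l L) := by
  unfold crossStat; fun_prop

lemma measurable_selfStat (k l : Fin K) (L : SCV M T →L[ℝ] SCV M T) :
    Measurable (selfStat C k l L) := by
  unfold selfStat; fun_prop

theorem lintegral_comp_shear (hC : ∀ k, (C k).PosDef) {k l : Fin K} (hkl : k ≠ l)
    (L : SCV M T →L[ℝ] SCV M T) {g : (Fin K → SCV M T) → ℝ≥0∞} (hg : Measurable g) :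
    ∫⁻ s, g (shear k l L s) ∂(sourceLaw C) =
      ∫⁻ s, ENNReal.ofReal (Real.exp (crossStat C k l L s - 1 / 2 * selfStat C k l L s)) * g s
        ∂(sourceLaw C) := by
  have hm1 := measurable_crossStat (C := C) k l L
  have hm2 := measurable_selfStat (C := C) k l L
  have hm3 := measurable_shear k l L
  unfold sourceLaw
  -- Integrate over coordinate `k` alone. As `l ≠ k`, the vector `L (s l)` is then constant and
  -- Cameron-Martin applies.
  refine lintegral_eq_of_lmarginal_eq {k} (by fun_prop) (by fun_prop) ?_
  rw [lmarginal_singleton, lmarginal_singleton]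
  funext s
  have h1 : ∀ x, shear k l L (Function.update s k x) =
      Function.update s k (x + L (s l)) := fun x => by
    simp [shear, Function.update_of_ne hkl.symm]
  simp_rw [h1]
  refine (lintegral_add_multivariateGaussian (hC k) (L (s l))
    (g := fun x => g (Function.update s k x)) (by fun_prop)).trans ?_
  simp [crossStat, selfStat, Function.update_of_ne hkl.symm]

theorem integral_comp_shear (hC : ∀ k, (C k).PosDef) {k l : Fin K} (hkl : k ≠ l)
    (L : SCV M T →L[ℝ] SCV M T) {h : (Fin K → SCV M T) → ℝ} (hh : Measurable h) :
    ∫ s, h (shear k l L s) ∂(sourceLaw C) =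
      ∫ s, Real.exp (crossStat C k l L s - 1 / 2 * selfStat C k l L s) * h s ∂(sourceLaw C) := by
  have hm1 := measurable_crossStat (C := C) k l L
  have hm2 := measurable_selfStat (C := C) k l L
  have hm3 := measurable_shear k l L
  have hmap : (sourceLaw C).map (shear k l L) = (sourceLaw C).withDensity
      fun s => ENNReal.ofReal (Real.exp (crossStat C k l L s - 1 / 2 * selfStat C k l L s)) := by
    ext A hA
    rw [← lintegral_indicator_one hA, ← lintegral_indicator_one hA,
      lintegral_map (measurable_one.indicator hA) hm3,
      lintegral_comp_shear hC hkl L (measurable_one.indicator hA),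
      lintegral_withDensity_eq_lintegral_mul _ (by fun_prop) (measurable_one.indicator hA)]
    rfl
  rw [← integral_map hm3.aemeasurable hh.aestronglyMeasurable, hmap,
    integral_withDensity_eq_integral_toReal_smul (by fun_prop) (by simp)]
  refine integral_congr_ae (.of_forall fun s => ?_)
  simp only [smul_eq_mul]
  rw [ENNReal.toReal_ofReal (Real.exp_nonneg _)]

lemma crossStat_smul (k l : Fin K) (L : SCV M T →L[ℝ] SCV M T) (ε : ℝ) (s : Fin K → SCV M T) :
    crossStat C k l (ε • L) s = ε * crossStat C k l L s := by
  simp [crossStat, inner_smul_right]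

lemma selfStat_smul (k l : Fin K) (L : SCV M T →L[ℝ] SCV M T) (ε : ℝ) (s : Fin K → SCV M T) :
    selfStat C k l (ε • L) s = ε ^ 2 * selfStat C k l L s := by
  simp [selfStat, inner_smul_right, inner_smul_left]
  ring

lemma exists_stat_bound (C : Fin K → Matrix (Fin M × Fin T) (Fin M × Fin T) ℝ) (k l : Fin K)
    (L : SCV M T →L[ℝ] SCV M T) :
    ∃ c : ℝ, 0 < c ∧ ∀ s, |crossStat C k l L s| ≤ c * ‖s‖ ^ 2 ∧
      |selfStat C k l L s| ≤ c * ‖s‖ ^ 2 := by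
  set P : SCV M T →L[ℝ] SCV M T := toEuclideanCLM (𝕜 := ℝ) (C k)⁻¹ with hP
  refine ⟨1 + ‖P‖ * ‖L‖ + ‖L‖ * (‖P‖ * ‖L‖), by positivity, fun s => ?_⟩
  have hk := norm_le_pi_norm s k
  have hl := norm_le_pi_norm s l
  have hL : ‖L (s l)‖ ≤ ‖L‖ * ‖s‖ := (L.le_opNorm _).trans (by gcongr)
  have hPL : ‖P (L (s l))‖ ≤ ‖P‖ * (‖L‖ * ‖s‖) := (P.le_opNorm _).trans (by gcongr)
  have h1 : |crossStat C k l L s| ≤ ‖s‖ * (‖P‖ * (‖L‖ * ‖s‖)) :=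
    (abs_real_inner_le_norm _ _).trans (by gcongr)
  have h2 : |selfStat C k l L s| ≤ (‖L‖ * ‖s‖) * (‖P‖ * (‖L‖ * ‖s‖)) :=
    (abs_real_inner_le_norm _ _).trans (by gcongr)
  have hs : 0 ≤ ‖s‖ ^ 2 := by positivity
  have hA : 0 ≤ ‖P‖ * ‖L‖ * ‖s‖ ^ 2 := by positivity
  have hB : 0 ≤ ‖L‖ * (‖P‖ * ‖L‖) * ‖s‖ ^ 2 := by positivity
  exact ⟨h1.trans (by linarith), h2.trans (by linarith)⟩

/-- After the change of measure, `ε` enters only through the smooth likelihood ratio, so `h` needs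
no regularity beyond measurability and square integrability. Differentiation under the integral is
dominated by Fernique's bound. -/
theorem hasDerivAt_integral_comp_shear (hC : ∀ k, (C k).PosDef) {k l : Fin K} (hkl : k ≠ l)
    (L : SCV M T →L[ℝ] SCV M T) {h : (Fin K → SCV M T) → ℝ} (hh : Measurable h)
    (hh2 : MemLp h 2 (sourceLaw C)) :
    HasDerivAt (fun ε : ℝ => ∫ s, h (shear k l (ε • L) s) ∂(sourceLaw C))
      (∫ s, crossStat C k l L s * h s ∂(sourceLaw C)) 0 := by
  have hm1 := measurable_crossStat (C := C) k l L
  have hm2 := measurable_selfStat (C := C) k l L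
  simp_rw [fun ε : ℝ => integral_comp_shear hC hkl (ε • L) hh, crossStat_smul, selfStat_smul]
  obtain ⟨a, ha, hint⟩ := IsGaussian.exists_integrable_exp_sq (sourceLaw C)
  obtain ⟨c, hc, hbd⟩ := exists_stat_bound C k l L
  set F' : ℝ → (Fin K → SCV M T) → ℝ := fun ε s =>
    Real.exp (ε * crossStat C k l L s - 1 / 2 * (ε ^ 2 * selfStat C k l L s)) *
      (crossStat C k l L s - ε * selfStat C k l L s) * h s with hF'
  -- The bound `a / (4 * c)` keeps the exponent below `a / 4 * ‖s‖ ^ 2`; the bound `1` controls the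
  -- prefactor by `2 * c * ‖s‖ ^ 2`. Absorbing `‖s‖ ^ 2` into another `exp (a / 4 * ‖s‖ ^ 2)` costs
  -- `4 / a`, whence `D`. The resulting exponent `a / 2` is what makes the bound square integrable.
  set ε₀ : ℝ := min 1 (a / (4 * c)) with hε₀
  have hε₀pos : 0 < ε₀ := by positivity
  set D : ℝ := 2 * c * (4 / a) with hD
  have hexp : MemLp (fun s : Fin K → SCV M T => D * Real.exp (a / 2 * ‖s‖ ^ 2)) 2
      (sourceLaw C) := by
    refine MemLp.const_mul ((memLp_two_iff_integrable_sq (by fun_prop)).2 ?_) _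
    refine hint.congr (.of_forall fun s => ?_)
    simp only
    rw [← Real.exp_nat_mul]
    congr 1
    push_cast
    ring
  have key := hasDerivAt_integral_of_dominated_loc_of_deriv_le
    (μ := sourceLaw C) (x₀ := (0 : ℝ)) (s := Metric.ball 0 ε₀)
    (F := fun ε s => Real.exp (ε * crossStat C k l L s -
      1 / 2 * (ε ^ 2 * selfStat C k l L s)) * h s)
    (F' := F') (bound := fun s => D * Real.exp (a / 2 * ‖s‖ ^ 2) * |h s|)
    (Metric.ball_mem_nhds _ hε₀pos) (.of_forall fun ε => by fun_prop)
    (by simpa using hh2.integrable (by norm_num)) (by simp only [hF']; fun_prop)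
    (.of_forall fun s ε hε => ?_) (hexp.integrable_mul hh2.abs) (.of_forall fun s ε _ => ?_)
  · refine key.2.congr_deriv ?_
    refine integral_congr_ae (.of_forall fun s => ?_)
    simp [hF']
  · obtain ⟨hb1, hb2⟩ := hbd s
    have hε' : |ε| < ε₀ := by simpa using hε
    have hε1 : |ε| ≤ 1 := hε'.le.trans (min_le_left _ _)
    have hε2 : |ε| ≤ a / (4 * c) := hε'.le.trans (min_le_right _ _)
    have hself : 0 ≤ selfStat C k l L s := inner_inv_nonneg (hC k) _
    have hn : 0 ≤ ‖s‖ ^ 2 := by positivity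
    have e1 : ε * crossStat C k l L s - 1 / 2 * (ε ^ 2 * selfStat C k l L s) ≤
        a / 4 * ‖s‖ ^ 2 := by
      have : ε * crossStat C k l L s ≤ a / (4 * c) * (c * ‖s‖ ^ 2) :=
        (le_abs_self _).trans (by rw [abs_mul]; gcongr)
      have h3 : a / (4 * c) * (c * ‖s‖ ^ 2) = a / 4 * ‖s‖ ^ 2 := by field_simp
      have : 0 ≤ ε ^ 2 * selfStat C k l L s := by positivity
      linarith
    have e2 : |crossStat C k l L s - ε * selfStat C k l L s| ≤ 2 * c * ‖s‖ ^ 2 := by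
      refine (abs_sub _ _).trans ?_
      rw [abs_mul]
      have : |ε| * |selfStat C k l L s| ≤ 1 * (c * ‖s‖ ^ 2) := by gcongr
      linarith
    have e3 : ‖s‖ ^ 2 ≤ 4 / a * Real.exp (a / 4 * ‖s‖ ^ 2) := by
      have := Real.add_one_le_exp (a / 4 * ‖s‖ ^ 2)
      calc ‖s‖ ^ 2 = 4 / a * (a / 4 * ‖s‖ ^ 2) := by field_simp
        _ ≤ _ := by gcongr; linarith
    rw [hF', Real.norm_eq_abs, abs_mul, abs_mul, Real.abs_exp]
    refine mul_le_mul_of_nonneg_right ?_ (abs_nonneg _)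
    calc _ ≤ Real.exp (a / 4 * ‖s‖ ^ 2) * (2 * c * (4 / a * Real.exp (a / 4 * ‖s‖ ^ 2))) :=
          mul_le_mul (Real.exp_le_exp.2 e1) (e2.trans (by gcongr)) (abs_nonneg _)
            (Real.exp_nonneg _)
      _ = D * (Real.exp (a / 4 * ‖s‖ ^ 2) * Real.exp (a / 4 * ‖s‖ ^ 2)) := by rw [hD]; ring
      _ = _ := by rw [← Real.exp_add]; ring_nf
  · have h1 : HasDerivAt (fun ε : ℝ => ε * crossStat C k l L s -
        1 / 2 * (ε ^ 2 * selfStat C k l L s))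
        (crossStat C k l L s - ε * selfStat C k l L s) ε := by
      refine (((hasDerivAt_id ε).mul_const _).sub
        (((hasDerivAt_pow 2 ε).mul_const _).const_mul (1 / 2))).congr_deriv ?_
      simp only [Nat.cast_ofNat, Nat.add_one_sub_one, pow_one]
      ring
    exact h1.exp.mul_const (h s)

end Shear

/-! ### Second moments of bilinear forms in two independent SCVs. -/

section CrossMoments

/-- Cauchy-Schwarz, from the discriminant of the nonnegative quadratic `t ↦ ∫ (t f + g)²`. -/
theorem sq_integral_mul_le {Ω : Type*} [MeasurableSpace Ω] {μ : Measure Ω} {f g : Ω → ℝ}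
    (hf : MemLp f 2 μ) (hg : MemLp g 2 μ) :
    (∫ x, f x * g x ∂μ) ^ 2 ≤ (∫ x, f x ^ 2 ∂μ) * ∫ x, g x ^ 2 ∂μ := by
  have hfg : Integrable (fun x => f x * g x) μ := hf.integrable_mul hg
  have h : ∀ t : ℝ, 0 ≤ (∫ x, f x ^ 2 ∂μ) * (t * t) + (2 * ∫ x, f x * g x ∂μ) * t +
      ∫ x, g x ^ 2 ∂μ := fun t => by
    have h0 : 0 ≤ ∫ x, (t * f x + g x) ^ 2 ∂μ := integral_nonneg fun x => sq_nonneg _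
    have h1 : ∀ x, (t * f x + g x) ^ 2 = t * t * f x ^ 2 + 2 * t * (f x * g x) + g x ^ 2 :=
      fun x => by ring
    simp_rw [h1] at h0
    have i1 : Integrable (fun x => t * t * f x ^ 2) μ := hf.integrable_sq.const_mul _
    have i2 : Integrable (fun x => 2 * t * (f x * g x)) μ := hfg.const_mul _
    have i12 : Integrable (fun x => t * t * f x ^ 2 + 2 * t * (f x * g x)) μ := i1.add i2
    rw [integral_add i12 hg.integrable_sq, integral_add i1 i2, integral_const_mul,
      integral_const_mul] at h0
    linarith
  have := discrim_le_zero h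
  unfold discrim at this
  linarith

variable {K M T : ℕ} {C : Fin K → Matrix (Fin M × Fin T) (Fin M × Fin T) ℝ}

lemma integral_comp_eval_sourceLaw {f : SCV M T → ℝ} (hf : Measurable f) (k : Fin K) :
    ∫ s, f (s k) ∂(sourceLaw C) = ∫ x, f x ∂(multivariateGaussian 0 (C k)) := by
  rw [← (measurePreserving_eval (fun k => multivariateGaussian 0 (C k)) k).map_eq,
    integral_map (measurable_pi_apply k).aemeasurable hf.aestronglyMeasurable]
  rfl

lemma integrable_comp_eval_sourceLaw {f : SCV M T → ℝ} (k : Fin K)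
    (hf : Integrable f (multivariateGaussian 0 (C k))) :
    Integrable (fun s : Fin K → SCV M T => f (s k)) (sourceLaw C) :=
  (measurePreserving_eval (fun k => multivariateGaussian 0 (C k)) k).integrable_comp_of_integrable
    hf

lemma energy_eq_trace (hC : ∀ k, (C k).PosDef) (k : Fin K) (m : Fin M) :
    energy C k m = (block (C k) m m).trace := by
  unfold energy
  rw [integral_finsetSum _ fun t _ => integrable_comp_eval_sourceLaw k
    (integrable_eval_mul_eval_multivariateGaussian (m, t) (m, t))]
  refine Finset.sum_congr rfl fun t _ => ?_
  rw [integral_comp_eval_sourceLaw (f := fun x => x (m, t) * x (m, t)) (by fun_prop),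
    integral_eval_mul_eval_multivariateGaussian (hC k).posSemidef]
  rfl

lemma trace_block_pos (hT : 0 < T) (hC : ∀ k, (C k).PosDef) (k : Fin K) (m : Fin M) :
    0 < (block (C k) m m).trace := by
  have : Nonempty (Fin T) := ⟨⟨0, hT⟩⟩
  exact Finset.sum_pos (fun t _ => (hC k).diag_pos) Finset.univ_nonempty

section Bilinear

variable {k l : Fin K}

lemma indepFun_eval (hkl : k ≠ l) : IndepFun (fun s : Fin K → SCV M T => s k)
    (fun s => s l) (sourceLaw C) :=
  (iIndepFun_pi (μ := fun k => multivariateGaussian 0 (C k)) (X := fun _ => id)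
    fun _ => aemeasurable_id).indepFun hkl

lemma indepFun_mul_mul (hkl : k ≠ l) (i a j b : Fin M × Fin T) :
    IndepFun (fun s : Fin K → SCV M T => s k i * s k a) (fun s => s l j * s l b) (sourceLaw C) :=
  (indepFun_eval (C := C) hkl).comp (φ := fun x : SCV M T => x i * x a)
    (ψ := fun x : SCV M T => x j * x b) (by fun_prop) (by fun_prop)

lemma integrable_mul_mul (hkl : k ≠ l) (i a j b : Fin M × Fin T) :
    Integrable (fun s : Fin K → SCV M T => (s k i * s k a) * (s l j * s l b)) (sourceLaw C) :=
  (indepFun_mul_mul hkl i a j b).integrable_mul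
    (integrable_comp_eval_sourceLaw k (integrable_eval_mul_eval_multivariateGaussian i a))
    (integrable_comp_eval_sourceLaw l (integrable_eval_mul_eval_multivariateGaussian j b))

lemma integral_mul_mul (hC : ∀ k, (C k).PosDef) (hkl : k ≠ l) (i a j b : Fin M × Fin T) :
    ∫ s : Fin K → SCV M T, (s k i * s k a) * (s l j * s l b) ∂(sourceLaw C) =
      C k i a * C l j b := by
  rw [(indepFun_mul_mul hkl i a j b).integral_fun_mul_eq_mul_integral (by fun_prop) (by fun_prop),
    integral_comp_eval_sourceLaw (f := fun x => x i * x a) (by fun_prop),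
    integral_comp_eval_sourceLaw (f := fun x => x j * x b) (by fun_prop),
    integral_eval_mul_eval_multivariateGaussian (hC k).posSemidef,
    integral_eval_mul_eval_multivariateGaussian (hC l).posSemidef]

lemma sq_bilinear (W : Matrix (Fin M × Fin T) (Fin M × Fin T) ℝ) (s : Fin K → SCV M T) :
    (∑ i, ∑ j, W i j * (s k i * s l j)) ^ 2 =
      ∑ i, ∑ j, ∑ a, ∑ b, (W i j * W a b) * ((s k i * s k a) * (s l j * s l b)) := by
  rw [sq]
  simp only [Finset.sum_mul, Finset.mul_sum]
  refine Finset.sum_congr rfl fun i _ => Finset.sum_congr rfl fun j _ =>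
    Finset.sum_congr rfl fun a _ => Finset.sum_congr rfl fun b _ => ?_
  ring

lemma memLp_bilinear (hkl : k ≠ l) (W : Matrix (Fin M × Fin T) (Fin M × Fin T) ℝ) :
    MemLp (fun s : Fin K → SCV M T => ∑ i, ∑ j, W i j * (s k i * s l j)) 2 (sourceLaw C) := by
  rw [memLp_two_iff_integrable_sq (by fun_prop)]
  simp_rw [sq_bilinear]
  exact integrable_finsetSum _ fun i _ => integrable_finsetSum _ fun j _ =>
    integrable_finsetSum _ fun a _ => integrable_finsetSum _ fun b _ =>
      (integrable_mul_mul hkl i a j b).const_mul _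

/-- Only second moments occur: by independence, each fourth-order product splits into an entry of `C
k` times an entry of `C l`. -/
lemma integral_sq_bilinear (hC : ∀ k, (C k).PosDef) (hkl : k ≠ l)
    (W : Matrix (Fin M × Fin T) (Fin M × Fin T) ℝ) :
    ∫ s : Fin K → SCV M T, (∑ i, ∑ j, W i j * (s k i * s l j)) ^ 2 ∂(sourceLaw C) =
      ∑ i, ∑ j, W i j * (C k * W * C l) i j := by
  have hi : ∀ i j a b, Integrable (fun s : Fin K → SCV M T =>
      (W i j * W a b) * ((s k i * s k a) * (s l j * s l b))) (sourceLaw C) :=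
    fun i j a b => (integrable_mul_mul hkl i a j b).const_mul _
  have hi1 := fun i j a => integrable_finsetSum Finset.univ fun b _ => hi i j a b
  have hi2 := fun i j => integrable_finsetSum Finset.univ fun a _ => hi1 i j a
  have hi3 := fun i => integrable_finsetSum Finset.univ fun j _ => hi2 i j
  simp_rw [sq_bilinear]
  rw [integral_finsetSum _ fun i _ => hi3 i]
  refine Finset.sum_congr rfl fun i _ => ?_
  rw [integral_finsetSum _ fun j _ => hi2 i j]
  refine Finset.sum_congr rfl fun j _ => ?_
  rw [integral_finsetSum _ fun a _ => hi1 i j a]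
  simp_rw [integral_finsetSum _ fun b _ => hi i j _ b, integral_const_mul,
    integral_mul_mul hC hkl, Matrix.mul_apply, Finset.sum_mul, Finset.mul_sum]
  rw [Finset.sum_comm]
  refine Finset.sum_congr rfl fun a _ => Finset.sum_congr rfl fun b _ => ?_
  rw [apply_comm (hC l) j]
  ring

end Bilinear

/-- Multiplication of the `m`-th component of an SCV by `α m`. -/
noncomputable def scale (α : Fin M → ℝ) : SCV M T →L[ℝ] SCV M T :=
  toEuclideanCLM (𝕜 := ℝ) (diagonal fun i => α i.1)

@[simp]
lemma scale_apply (α : Fin M → ℝ) (x : SCV M T) (i : Fin M × Fin T) :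
    scale α x i = α i.1 * x i := by
  unfold scale
  rw [ofLp_toEuclideanCLM, mulVec_diagonal]

lemma crossStat_scale (k l : Fin K) (α : Fin M → ℝ) (s : Fin K → SCV M T) :
    crossStat C k l (scale α) s = ∑ i, ∑ j, ((C k)⁻¹ i j * α j.1) * (s k i * s l j) := by
  unfold crossStat
  rw [inner_toEuclideanCLM]
  simp only [dotProduct, mulVec, scale_apply, Finset.mul_sum]
  exact Finset.sum_congr rfl fun i _ => Finset.sum_congr rfl fun j _ => by ring

/-- The matrix of the bilinear form `crossStat C k l (scale α) + crossStat C l k (scale β)`. -/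
noncomputable def scoreMatrix (C : Fin K → Matrix (Fin M × Fin T) (Fin M × Fin T) ℝ) (k l : Fin K)
    (α β : Fin M → ℝ) : Matrix (Fin M × Fin T) (Fin M × Fin T) ℝ :=
  (C k)⁻¹ * diagonal (fun i => α i.1) + diagonal (fun i => β i.1) * (C l)⁻¹

lemma crossStat_scale_add (hC : ∀ k, (C k).PosDef) (k l : Fin K) (α β : Fin M → ℝ)
    (s : Fin K → SCV M T) :
    crossStat C k l (scale α) s + crossStat C l k (scale β) s =
      ∑ i, ∑ j, scoreMatrix C k l α β i j * (s k i * s l j) := by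
  rw [crossStat_scale, crossStat_scale, Finset.sum_comm (f := fun i j =>
    ((C l)⁻¹ i j * β j.1) * (s l i * s k j)), ← Finset.sum_add_distrib]
  refine Finset.sum_congr rfl fun i _ => ?_
  rw [← Finset.sum_add_distrib]
  refine Finset.sum_congr rfl fun j _ => ?_
  simp only [scoreMatrix, Matrix.add_apply, mul_diagonal, diagonal_mul]
  rw [inv_apply_comm (hC l) j]
  ring

lemma memLp_crossStat {k l : Fin K} (hkl : k ≠ l) (α : Fin M → ℝ) :
    MemLp (crossStat C k l (scale α)) 2 (sourceLaw C) := by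
  refine (memLp_bilinear hkl (.of fun i j => (C k)⁻¹ i j * α j.1)).ae_eq (.of_forall fun s => ?_)
  rw [crossStat_scale]
  rfl

lemma sum_inv_mul_self (hC : ∀ k, (C k).PosDef) (k : Fin K) (j : Fin M × Fin T) :
    ∑ i, (C k)⁻¹ i j * C k i j = 1 := by
  have h := congrFun (congrFun (Matrix.mul_nonsing_inv _ (hC k).det_pos.ne'.isUnit) j) j
  rw [Matrix.mul_apply, one_apply_eq] at h
  rw [← h]
  exact Finset.sum_congr rfl fun i _ => by rw [apply_comm (hC k) i, mul_comm]

/-- Write `W` for `scoreMatrix` and `D_α`, `D_β` for the diagonal matrices. Then `C k * W * C l`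
collapses to `D_α C l + C k D_β`. Paired entrywise with `W`, the pure terms give the two `kappa`
forms, and each mixed term gives `T (α ⬝ᵥ β)` because `C⁻¹ C` has unit diagonal. -/
theorem integral_sq_crossStat_add (hT : 0 < T) (hC : ∀ k, (C k).PosDef) {k l : Fin K}
    (hkl : k ≠ l) (α β : Fin M → ℝ) :
    ∫ s, (crossStat C k l (scale α) s + crossStat C l k (scale β) s) ^ 2 ∂(sourceLaw C) =
      T * (α ⬝ᵥ kappa C k l *ᵥ α + β ⬝ᵥ kappa C l k *ᵥ β + 2 * (α ⬝ᵥ β)) := by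
  simp_rw [crossStat_scale_add hC]
  rw [integral_sq_bilinear hC hkl]
  have hW : C k * scoreMatrix C k l α β * C l =
      diagonal (fun i => α i.1) * C l + C k * diagonal (fun i => β i.1) := by
    have h1 := Matrix.mul_nonsing_inv _ (hC k).det_pos.ne'.isUnit
    have h2 := Matrix.nonsing_inv_mul _ (hC l).det_pos.ne'.isUnit
    rw [scoreMatrix, Matrix.mul_add, Matrix.add_mul, ← Matrix.mul_assoc (C k), h1, Matrix.one_mul,
      Matrix.mul_assoc, Matrix.mul_assoc, h2, Matrix.mul_one]
  have hαβ : T * (α ⬝ᵥ β) = ∑ j : Fin M × Fin T, α j.1 * β j.1 := by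
    simp [Fintype.sum_prod_type, dotProduct, Finset.mul_sum]
  have e1 : ∑ i : Fin M × Fin T, ∑ j, (C k)⁻¹ i j * C k i j * (α j.1 * β j.1) = T * (α ⬝ᵥ β) := by
    rw [Finset.sum_comm, hαβ]
    exact Finset.sum_congr rfl fun j _ => by rw [← Finset.sum_mul, sum_inv_mul_self hC, one_mul]
  have e2 : ∑ i : Fin M × Fin T, ∑ j, (C l)⁻¹ j i * C l j i * (α i.1 * β i.1) = T * (α ⬝ᵥ β) := by
    rw [hαβ]
    exact Finset.sum_congr rfl fun j _ => by rw [← Finset.sum_mul, sum_inv_mul_self hC, one_mul]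
  rw [mul_add, mul_add, mul_dotProduct_kappa hT hC, mul_dotProduct_kappa hT hC,
    show (T : ℝ) * (2 * (α ⬝ᵥ β)) = T * (α ⬝ᵥ β) + T * (α ⬝ᵥ β) by ring]
  nth_rw 1 [← e1]
  rw [← e2, hW]
  simp only [← Finset.sum_add_distrib]
  refine Finset.sum_congr rfl fun i _ => Finset.sum_congr rfl fun j _ => ?_
  simp only [scoreMatrix, Matrix.add_apply, mul_diagonal, diagonal_mul]
  rw [inv_apply_comm (hC l) j, apply_comm (hC l) j]
  ring

end CrossMoments

/-! ### Correlation of the relative coefficient with the shear statistics. -/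

section Estimators

section Mobius

variable {Ω : Type*} [MeasurableSpace Ω] {μ : Measure Ω}

/-- The integrand is `f (r / (1 - ε β r))` with `f ρ = ρ / (1 + δ ρ²)`, after clearing denominators.
This removes the pole at `ε β r = 1`, and the derivative in `ε` is at most `|β| / δ` everywhere. -/
lemma hasDerivAt_integral_mobius [IsFiniteMeasure μ] {r : Ω → ℝ} (hr : Measurable r) (β : ℝ)
    {δ : ℝ} (hδ : 0 < δ) :
    HasDerivAt (fun ε : ℝ => ∫ x, r x * (1 - ε * β * r x) /
        ((1 - ε * β * r x) ^ 2 + δ * r x ^ 2) ∂μ)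
      (∫ x, β * (r x ^ 2 * (1 - δ * r x ^ 2) / (1 + δ * r x ^ 2) ^ 2) ∂μ) 0 := by
  have hpos : ∀ ρ ε : ℝ, 0 < (1 - ε * β * ρ) ^ 2 + δ * ρ ^ 2 := fun ρ ε => by
    rcases eq_or_ne ρ 0 with rfl | h
    · norm_num
    · positivity
  have key := hasDerivAt_integral_of_dominated_loc_of_deriv_le
    (μ := μ) (x₀ := (0 : ℝ)) (s := Set.univ)
    (F := fun ε x => r x * (1 - ε * β * r x) / ((1 - ε * β * r x) ^ 2 + δ * r x ^ 2))
    (F' := fun ε x => β * r x ^ 2 * ((1 - ε * β * r x) ^ 2 - δ * r x ^ 2) /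
      ((1 - ε * β * r x) ^ 2 + δ * r x ^ 2) ^ 2) (bound := fun _ => |β| / δ)
    Filter.univ_mem (.of_forall fun ε => Measurable.aestronglyMeasurable (by fun_prop)) ?_
    (Measurable.aestronglyMeasurable (by fun_prop))
    (.of_forall fun x ε _ => ?_) (integrable_const _) (.of_forall fun x ε _ => ?_)
  · refine key.2.congr_deriv (integral_congr_ae (.of_forall fun x => ?_))
    simp only [zero_mul, sub_zero, one_pow]
    ring
  · refine Integrable.of_bound (C := 1 + 1 / δ)
      (Measurable.aestronglyMeasurable (by fun_prop)) (.of_forall fun x => ?_)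
    have h0 : 0 < 1 + δ * r x ^ 2 := by positivity
    simp only [zero_mul, sub_zero, one_pow, mul_one]
    rw [Real.norm_eq_abs, abs_div, abs_of_pos h0, div_le_iff₀ h0]
    have h1 : |r x| ≤ 1 + r x ^ 2 := by
      rw [← sq_abs (r x)]; nlinarith [sq_nonneg (|r x| - 1), abs_nonneg (r x)]
    have h2 : (1 + 1 / δ) * (1 + δ * r x ^ 2) = 1 + r x ^ 2 + 1 / δ + δ * r x ^ 2 := by
      field_simp; ring
    have h3 : 0 ≤ 1 / δ := by positivity
    have h4 : 0 ≤ δ * r x ^ 2 := by positivity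
    linarith
  · set u := 1 - ε * β * r x with hu
    have h0 : 0 < u ^ 2 + δ * r x ^ 2 := hpos (r x) ε
    rw [Real.norm_eq_abs, abs_div, abs_mul, abs_mul, abs_of_pos (by positivity :
      0 < (u ^ 2 + δ * r x ^ 2) ^ 2), abs_of_nonneg (sq_nonneg (r x)),
      div_le_div_iff₀ (by positivity) hδ]
    have h1 : |u ^ 2 - δ * r x ^ 2| ≤ u ^ 2 + δ * r x ^ 2 :=
      abs_le.2 ⟨by nlinarith [sq_nonneg u], by nlinarith [sq_nonneg (r x)]⟩
    calc |β| * r x ^ 2 * |u ^ 2 - δ * r x ^ 2| * δ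
        ≤ |β| * r x ^ 2 * (u ^ 2 + δ * r x ^ 2) * δ := by gcongr
      _ = |β| * ((δ * r x ^ 2) * (u ^ 2 + δ * r x ^ 2)) := by ring
      _ ≤ |β| * ((u ^ 2 + δ * r x ^ 2) * (u ^ 2 + δ * r x ^ 2)) := by
        gcongr
        nlinarith [sq_nonneg u]
      _ = _ := by ring
  · have hu : HasDerivAt (fun ε : ℝ => 1 - ε * β * r x) (-(β * r x)) ε :=
      ((((hasDerivAt_id ε).mul_const β).mul_const (r x)).const_sub 1).congr_deriv (by simp)
    have h0 := hpos (r x) ε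
    refine ((hu.const_mul (r x)).div ((hu.fun_pow 2).add_const _) h0.ne').congr_deriv ?_
    congr 1
    simp only [Nat.cast_ofNat, Nat.add_one_sub_one, pow_one]
    ring

/-- Let `δ = 1 / (n + 1)` tend to `0`. The integrands are dominated by `|Q r|` and `|β| r²`
respectively. -/
lemma integral_mul_eq_of_forall_regularized {Q r : Ω → ℝ} (hr : Measurable r)
    (hQ : MemLp Q 2 μ) (hr2 : MemLp r 2 μ) (β : ℝ)
    (h : ∀ δ : ℝ, 0 < δ → ∫ x, Q x * (r x / (1 + δ * r x ^ 2)) ∂μ =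
      ∫ x, β * (r x ^ 2 * (1 - δ * r x ^ 2) / (1 + δ * r x ^ 2) ^ 2) ∂μ) :
    ∫ x, Q x * r x ∂μ = β * ∫ x, r x ^ 2 ∂μ := by
  have hlim : ∀ x, Filter.Tendsto (fun n : ℕ => 1 / ((n : ℝ) + 1) * r x ^ 2) Filter.atTop
      (nhds 0) := fun x => by
    simpa using (tendsto_one_div_add_atTop_nhds_zero_nat (𝕜 := ℝ)).mul_const (r x ^ 2)
  have hpos : ∀ (n : ℕ) (x : Ω), 0 ≤ 1 / ((n : ℝ) + 1) * r x ^ 2 := fun n x => by positivity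
  have hQm := hQ.aestronglyMeasurable
  have t1 : Filter.Tendsto (fun n : ℕ => ∫ x, Q x * (r x / (1 + 1 / ((n : ℝ) + 1) * r x ^ 2)) ∂μ)
      Filter.atTop (nhds (∫ x, Q x * r x ∂μ)) := by
    refine tendsto_integral_of_dominated_convergence (fun x => ‖Q x * r x‖)
      (fun n => hQm.mul (Measurable.aestronglyMeasurable (by fun_prop))) (hQ.integrable_mul hr2).norm
      (fun n => .of_forall fun x => ?_) (.of_forall fun x => ?_)
    · rw [norm_mul, norm_mul, norm_div]
      gcongr
      refine div_le_self (norm_nonneg _) ?_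
      rw [Real.norm_eq_abs]
      exact (by linarith [hpos n x] : (1 : ℝ) ≤ _).trans (le_abs_self _)
    · have := ((tendsto_const_nhds (x := r x)).div ((hlim x).const_add 1) (by norm_num)).const_mul
        (Q x)
      simpa using this
  have t2 : Filter.Tendsto (fun n : ℕ => ∫ x, β * (r x ^ 2 * (1 - 1 / ((n : ℝ) + 1) * r x ^ 2) /
      (1 + 1 / ((n : ℝ) + 1) * r x ^ 2) ^ 2) ∂μ)
      Filter.atTop (nhds (∫ x, β * r x ^ 2 ∂μ)) := by
    refine tendsto_integral_of_dominated_convergence (fun x => |β| * r x ^ 2)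
      (fun n => Measurable.aestronglyMeasurable (by fun_prop)) (hr2.integrable_sq.const_mul _)
      (fun n => .of_forall fun x => ?_) (.of_forall fun x => ?_)
    · have h0 := hpos n x
      set w := 1 / ((n : ℝ) + 1) * r x ^ 2
      rw [Real.norm_eq_abs, abs_mul, abs_div, abs_mul, abs_of_nonneg (sq_nonneg (r x)),
        abs_of_pos (by positivity : 0 < (1 + w) ^ 2)]
      gcongr
      refine div_le_of_le_mul₀ (by positivity) (by positivity) ?_
      gcongr
      exact abs_le.2 ⟨by nlinarith, by nlinarith⟩
    · have := ((((hlim x).const_sub 1).const_mul (r x ^ 2)).div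
        (((hlim x).const_add 1).pow 2) (by norm_num)).const_mul β
      simpa using this
  rw [← integral_const_mul]
  refine tendsto_nhds_unique t1 (t2.congr fun n => (h _ (by positivity)).symm)

end Mobius

variable {K M T : ℕ}

lemma shear_smul_scale (k l : Fin K) (α : Fin M → ℝ) (ε : ℝ) :
    shear k l (ε • scale (T := T) α) = shear k l (scale (ε • α)) := by
  have : ε • scale (T := T) α = scale (ε • α) := by
    ext x i
    simp [mul_assoc]
  rw [this]

lemma mix_shear (A : Fin M → Matrix (Fin K) (Fin K) ℝ) {k l : Fin K} (hkl : k ≠ l)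
    (α : Fin M → ℝ) (s : Fin K → SCV M T) :
    mix A (shear k l (scale α) s) = mix (fun n => A n * transvection k l (α n)) s := by
  funext n i t
  simp only [mix]
  have h1 : ∀ j, A n i j * (shear k l (scale α) s) j (n, t) =
      A n i j * s j (n, t) + if j = k then A n i k * (α n * s l (n, t)) else 0 := fun j => by
    rcases eq_or_ne j k with rfl | h
    · simp [shear, mul_add]
    · simp [shear, h]
  have h2 : ∀ j, (A n * transvection k l (α n)) i j * s j (n, t) =
      A n i j * s j (n, t) + if j = l then A n i k * (α n * s l (n, t)) else 0 := fun j => by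
    rcases eq_or_ne j l with rfl | h
    · simp; ring
    · simp [h]
  simp_rw [h1, h2, Finset.sum_add_distrib]
  simp

lemma measurable_mix (A : Fin M → Matrix (Fin K) (Fin K) ℝ) :
    Measurable (mix (T := T) A) := by
  refine measurable_pi_iff.2 fun n => measurable_pi_iff.2 fun i => measurable_pi_iff.2 fun t => ?_
  simp only [mix]
  fun_prop

lemma measurable_relCoef {Bhat : Data K M T → Fin M → Matrix (Fin K) (Fin K) ℝ}
    (hB : ∀ n i j, Measurable fun X => Bhat X n i j) (A : Fin M → Matrix (Fin K) (Fin K) ℝ)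
    (k l : Fin K) (m : Fin M) :
    Measurable fun s => relCoef (Bhat (mix A s) m) (A m) k l := by
  have h : ∀ i j, Measurable fun s => Bhat (mix A s) m i j :=
    fun i j => (hB m i j).comp (measurable_mix A)
  simp only [relCoef, Matrix.mul_apply]
  exact (Finset.measurable_sum _ fun j _ => (h k j).mul_const _).div
    (Finset.measurable_sum _ fun j _ => (h k j).mul_const _)

lemma inv_transvection {k l : Fin K} (hkl : k ≠ l) (c : ℝ) :
    (transvection k l c)⁻¹ = transvection k l (-c) :=
  Matrix.inv_eq_right_inv (by rw [transvection_mul_transvection_same _ _ hkl]; simp)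

lemma isUnit_transvection {k l : Fin K} (hkl : k ≠ l) (c : ℝ) :
    IsUnit (transvection k l c) := by
  rw [Matrix.isUnit_iff_isUnit_det, det_transvection_of_ne _ _ hkl]
  exact isUnit_one

/-- Shearing the sources multiplies the observations from the left by `A n * transvection k l (α n)
* (A n)⁻¹`, an admissible `D` for equivariance. -/
lemma Equivariant.mul_shear {Bhat : Data K M T → Fin M → Matrix (Fin K) (Fin K) ℝ}
    (hB : Equivariant Bhat) {A : Fin M → Matrix (Fin K) (Fin K) ℝ} (hA : ∀ n, IsUnit (A n))
    {k l : Fin K} (hkl : k ≠ l) (α : Fin M → ℝ) (s : Fin K → SCV M T) (m : Fin M) :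
    Bhat (mix A (shear k l (scale α) s)) m * A m =
      Bhat (mix A s) m * A m * transvection k l (-α m) := by
  have hA' : ∀ n, IsUnit (A n).det := fun n => (Matrix.isUnit_iff_isUnit_det _).1 (hA n)
  have hAi : ∀ n, IsUnit (A n)⁻¹ := fun n => (Matrix.isUnit_nonsing_inv_iff).2 (hA n)
  have h := hB (fun n => A n * transvection k l (α n) * (A n)⁻¹)
    (fun n => ((hA n).mul (isUnit_transvection hkl _)).mul (hAi n)) (mix A s) m
  have hX : (fun n i t => ∑ j, (A n * transvection k l (α n) * (A n)⁻¹) i j * mix A s n j t) =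
      mix A (shear k l (scale α) s) := by
    rw [mix_shear A hkl]
    funext n i t
    have e : A n * transvection k l (α n) = (A n * transvection k l (α n) * (A n)⁻¹) * A n := by
      rw [Matrix.mul_assoc, Matrix.nonsing_inv_mul _ (hA' n), Matrix.mul_one]
    simp only [mix]
    conv_rhs => rw [e]
    generalize A n * transvection k l (α n) * (A n)⁻¹ = D
    simp only [Matrix.mul_apply, Finset.sum_mul, Finset.mul_sum, mul_assoc]
    rw [Finset.sum_comm]
  rw [hX] at h
  rw [h, Matrix.mul_inv_rev, Matrix.mul_inv_rev, Matrix.nonsing_inv_nonsing_inv _ (hA' m),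
    inv_transvection hkl]
  simp only [Matrix.mul_assoc]
  rw [Matrix.nonsing_inv_mul _ (hA' m), Matrix.mul_one]

variable {C : Fin K → Matrix (Fin M × Fin T) (Fin M × Fin T) ℝ}

lemma add_smul_mul_single {k l : Fin K} (A : Matrix (Fin K) (Fin K) ℝ) (c ε : ℝ) :
    A + ε • (A * single k l c) = A * transvection k l (ε * c) := by
  simp [transvection, Matrix.mul_add, ← Matrix.mul_smul]

/-- For a locally unbiased estimator, differentiating the bias along a shear of the sources gives
the correlation of the relative coefficient with the score of the shear. -/
lemma LocallyUnbiased.integral_crossStat_mul (hC : ∀ k, (C k).PosDef)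
    {Bhat : Data K M T → Fin M → Matrix (Fin K) (Fin K) ℝ}
    (hB : ∀ n i j, Measurable fun X => Bhat X n i j)
    {A : Fin M → Matrix (Fin K) (Fin K) ℝ} (hA : ∀ n, IsUnit (A n)) {k l : Fin K} {m : Fin M}
    (hU : LocallyUnbiased C Bhat k l m A)
    (hL2 : MemLp (fun s => relCoef (Bhat (mix A s) m) (A m) k l) 2 (sourceLaw C))
    {i j : Fin K} (hij : i ≠ j) (α : Fin M → ℝ) {d : ℝ}
    (hd : ∀ c, relCoef (transvection i j (-c)) 1 k l = c * d) :
    ∫ s, crossStat C i j (scale α) s * relCoef (Bhat (mix A s) m) (A m) k l ∂(sourceLaw C) =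
      α m * d := by
  have hder := hasDerivAt_integral_comp_shear hC hij (scale α) (measurable_relCoef hB A k l m) hL2
  -- In this direction `A + ε • H` is exactly `A` times a transvection, so perturbing the mixing
  -- matrices is the same as shearing the sources.
  have hbias := hU.2 fun n => A n * single i j (α n)
  have hA' : IsUnit (A m).det := (Matrix.isUnit_iff_isUnit_det _).1 (hA m)
  have e : ∀ ε : ℝ, (A + ε • fun n => A n * single i j (α n)) =
      fun n => A n * transvection i j (ε * α n) := fun ε => by
    funext n
    simp only [Pi.add_apply, Pi.smul_apply, add_smul_mul_single]
  have hfun : (fun ε : ℝ => bias C Bhat k l m A (A + ε • fun n => A n * single i j (α n))) =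
      fun ε => ∫ s, relCoef (Bhat (mix A (shear i j (ε • scale α) s)) m) (A m) k l ∂(sourceLaw C) -
        ε * (α m * d) := by
    funext ε
    simp_rw [e, bias, shear_smul_scale, mix_shear A hij]
    congr 1
    rw [Matrix.mul_inv_rev, inv_transvection hij]
    have : relCoef (transvection i j (-(ε * α m)) * (A m)⁻¹) (A m) k l =
        relCoef (transvection i j (-(ε * α m))) 1 k l := by
      simp only [relCoef]
      rw [Matrix.mul_assoc, Matrix.nonsing_inv_mul _ hA']
    rw [this, hd]
    ring
  rw [hfun] at hbias
  have h2 := hder.sub ((hasDerivAt_id (0 : ℝ)).mul_const (α m * d))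
  have := hbias.unique h2
  linarith

lemma relCoef_transvection {k l : Fin K} (hkl : k ≠ l) (c : ℝ) :
    relCoef (transvection k l (-c)) 1 k l = c * (-1) := by
  simp [relCoef, transvection, hkl, hkl.symm]

lemma relCoef_transvection_swap {k l : Fin K} (hkl : k ≠ l) (c : ℝ) :
    relCoef (transvection l k (-c)) 1 k l = c * 0 := by
  simp [relCoef, transvection, hkl, hkl.symm]

section EquivariantMoments

variable {Bhat : Data K M T → Fin M → Matrix (Fin K) (Fin K) ℝ}
  {A : Fin M → Matrix (Fin K) (Fin K) ℝ} {k l : Fin K} {m : Fin M}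

lemma Equivariant.relCoef_shear (hE : Equivariant Bhat) (hA : ∀ n, IsUnit (A n)) (hkl : k ≠ l)
    (α : Fin M → ℝ) {s : Fin K → SCV M T} (hs : (Bhat (mix A s) m * A m) k k ≠ 0) :
    relCoef (Bhat (mix A (shear k l (scale α) s)) m) (A m) k l =
      relCoef (Bhat (mix A s) m) (A m) k l - α m := by
  simp only [relCoef, hE.mul_shear hA hkl]
  rw [mul_transvection_apply_same, mul_transvection_apply_of_ne _ _ _ _ hkl]
  field_simp
  ring

lemma Equivariant.relCoef_shear_swap (hE : Equivariant Bhat) (hA : ∀ n, IsUnit (A n))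
    (hkl : k ≠ l) (β : Fin M → ℝ) {s : Fin K → SCV M T}
    (hs : (Bhat (mix A s) m * A m) k k ≠ 0) :
    relCoef (Bhat (mix A (shear l k (scale β) s)) m) (A m) k l =
      relCoef (Bhat (mix A s) m) (A m) k l /
        (1 - β m * relCoef (Bhat (mix A s) m) (A m) k l) := by
  simp only [relCoef, hE.mul_shear hA hkl.symm]
  rw [mul_transvection_apply_same, mul_transvection_apply_of_ne _ _ _ _ hkl.symm, div_div]
  congr 1
  field_simp
  ring

lemma Equivariant.integral_crossStat_mul (hC : ∀ k, (C k).PosDef)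
    (hB : ∀ n i j, Measurable fun X => Bhat X n i j) (hE : Equivariant Bhat)
    (hA : ∀ n, IsUnit (A n)) (hkl : k ≠ l)
    (hne : ∀ᵐ s ∂(sourceLaw C), (Bhat (mix A s) m * A m) k k ≠ 0)
    (hL2 : MemLp (fun s => relCoef (Bhat (mix A s) m) (A m) k l) 2 (sourceLaw C))
    (α : Fin M → ℝ) :
    ∫ s, crossStat C k l (scale α) s * relCoef (Bhat (mix A s) m) (A m) k l ∂(sourceLaw C) =
      -α m := by
  have hder := hasDerivAt_integral_comp_shear hC hkl (scale α) (measurable_relCoef hB A k l m) hL2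
  refine hder.unique ?_
  have hfun : (fun ε : ℝ => ∫ s, relCoef (Bhat (mix A (shear k l (ε • scale α) s)) m) (A m) k l
      ∂(sourceLaw C)) =
      fun ε => ∫ s, relCoef (Bhat (mix A s) m) (A m) k l ∂(sourceLaw C) - ε * α m := by
    funext ε
    have : ∀ᵐ s ∂(sourceLaw C), relCoef (Bhat (mix A (shear k l (ε • scale α) s)) m) (A m) k l =
        relCoef (Bhat (mix A s) m) (A m) k l - ε * α m := by
      filter_upwards [hne] with s hs
      rw [shear_smul_scale, hE.relCoef_shear hA hkl _ hs]
      rfl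
    rw [integral_congr_ae this, integral_sub (hL2.integrable (by norm_num)) (integrable_const _)]
    simp
  rw [hfun]
  exact (((hasDerivAt_id (0 : ℝ)).mul_const (α m)).const_sub _).congr_deriv (by simp)

/-- Formally this differentiates the mean of `r / (1 - ε β r)`, which need not be integrable for `ε
≠ 0`. The derivative is therefore taken for the bounded truncation `f ∘ r`, and `δ → 0` afterwards.
-/
lemma Equivariant.integral_crossStat_swap_mul (hC : ∀ k, (C k).PosDef)
    (hB : ∀ n i j, Measurable fun X => Bhat X n i j) (hE : Equivariant Bhat)
    (hA : ∀ n, IsUnit (A n)) (hkl : k ≠ l)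
    (hne : ∀ᵐ s ∂(sourceLaw C), (Bhat (mix A s) m * A m) k k ≠ 0)
    (hL2 : MemLp (fun s => relCoef (Bhat (mix A s) m) (A m) k l) 2 (sourceLaw C))
    (β : Fin M → ℝ) :
    ∫ s, crossStat C l k (scale β) s * relCoef (Bhat (mix A s) m) (A m) k l ∂(sourceLaw C) =
      β m * ∫ s, relCoef (Bhat (mix A s) m) (A m) k l ^ 2 ∂(sourceLaw C) := by
  set r : (Fin K → SCV M T) → ℝ := fun s => relCoef (Bhat (mix A s) m) (A m) k l with hr
  have hrm : Measurable r := measurable_relCoef hB A k l m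
  refine integral_mul_eq_of_forall_regularized hrm (memLp_crossStat hkl.symm β) hL2 (β m)
    fun δ hδ => ?_
  set f : ℝ → ℝ := fun ρ => ρ / (1 + δ * ρ ^ 2) with hf
  have hfm : Measurable fun s => f (r s) := by simp only [hf]; fun_prop
  have hf2 : MemLp (fun s => f (r s)) 2 (sourceLaw C) := by
    refine hL2.mono hfm.aestronglyMeasurable (.of_forall fun s => ?_)
    simp only [hf]
    rw [norm_div]
    refine div_le_self (norm_nonneg _) ?_
    rw [Real.norm_eq_abs]
    have : 0 ≤ δ * r s ^ 2 := by positivity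
    exact (by linarith : (1 : ℝ) ≤ _).trans (le_abs_self _)
  have hder := hasDerivAt_integral_comp_shear hC hkl.symm (scale β) hfm hf2
  refine hder.unique ?_
  have hfun : (fun ε : ℝ => ∫ s, f (r (shear l k (ε • scale β) s)) ∂(sourceLaw C)) =
      fun ε => ∫ s, r s * (1 - ε * β m * r s) /
        ((1 - ε * β m * r s) ^ 2 + δ * r s ^ 2) ∂(sourceLaw C) := by
    funext ε
    refine integral_congr_ae ?_
    filter_upwards [hne] with s hs
    have h1 : r (shear l k (ε • scale β) s) = r s / (1 - ε * β m * r s) := by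
      simp only [hr]
      rw [shear_smul_scale, hE.relCoef_shear_swap hA hkl _ hs]
      rfl
    rw [h1]
    simp only [hf]
    set u := 1 - ε * β m * r s
    -- At the pole the sheared coefficient is `r / 0 = 0`, and the cleared formula vanishes there
    -- too.
    rcases eq_or_ne u 0 with hu | hu
    · simp [hu]
    · have h0 : 0 < u ^ 2 + δ * r s ^ 2 := by positivity
      field_simp
  rw [hfun]
  exact hasDerivAt_integral_mobius hrm (β m) hδ

end EquivariantMoments

/-- The Cauchy-Schwarz inequality at the least favorable pair of shears. -/
theorem sq_le_of_integral_crossStat_mul (hT : 0 < T) (hC : ∀ k, (C k).PosDef) {k l : Fin K}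
    (hkl : k ≠ l) (m : Fin M) (hG : IsUnit (kappa C k l - (kappa C l k)⁻¹))
    {r : (Fin K → SCV M T) → ℝ} (hr : MemLp r 2 (sourceLaw C)) {w : ℝ}
    (hα : ∀ α, ∫ s, crossStat C k l (scale α) s * r s ∂(sourceLaw C) = -α m)
    (hβ : ∀ β, ∫ s, crossStat C l k (scale β) s * r s ∂(sourceLaw C) = β m * w) :
    (T * (1 / T * (Pi.single m 1 ⬝ᵥ (kappa C k l - (kappa C l k)⁻¹)⁻¹ *ᵥ Pi.single m 1)) +
        T * crossTerm C k l m * w) ^ 2 ≤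
      T * (T * (1 / T * (Pi.single m 1 ⬝ᵥ
        (kappa C k l - (kappa C l k)⁻¹)⁻¹ *ᵥ Pi.single m 1))) *
        ∫ s, r s ^ 2 ∂(sourceLaw C) := by
  have hT' : (T : ℝ) ≠ 0 := by positivity
  set G := kappa C k l - (kappa C l k)⁻¹ with hGdef
  -- For fixed `α`, the choice `β = -𝒦_{lk}⁻¹ α` minimizes the second moment, leaving `T αᵀ G α`.
  -- The choice `α = G⁻¹ e_m` is stationary for `(α m)² / αᵀ G α` and makes `αᵀ G α = α m`.
  set α : Fin M → ℝ := G⁻¹ *ᵥ Pi.single m 1 with hαdef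
  set β : Fin M → ℝ := -((kappa C l k)⁻¹ *ᵥ α) with hβdef
  have hGdet : IsUnit G.det := (Matrix.isUnit_iff_isUnit_det _).1 hG
  have hKdet := (posDef_kappa hT hC l k).det_pos.ne'.isUnit
  have e1 : Pi.single m 1 ⬝ᵥ α = α m := by simp
  have e2 : (T : ℝ) * crossTerm C k l m = -β m := by
    rw [crossTerm, ← hGdef, ← mulVec_mulVec, ← hαdef, hβdef]
    simp only [single_one_dotProduct, Pi.neg_apply, neg_neg]
    field_simp
  have hKβ : kappa C l k *ᵥ β = -α := by
    rw [hβdef, mulVec_neg, mulVec_mulVec, Matrix.mul_nonsing_inv _ hKdet, one_mulVec]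
  have hGα : G *ᵥ α = Pi.single m 1 := by
    rw [hαdef, mulVec_mulVec, Matrix.mul_nonsing_inv _ hGdet, one_mulVec]
  have hquad : α ⬝ᵥ kappa C k l *ᵥ α + β ⬝ᵥ kappa C l k *ᵥ β + 2 * (α ⬝ᵥ β) = α m := by
    have h1 : α ⬝ᵥ G *ᵥ α = α m := by rw [hGα]; simp
    rw [hGdef, sub_mulVec, dotProduct_sub] at h1
    rw [hKβ, dotProduct_neg, dotProduct_comm β α, ← h1, hβdef, dotProduct_neg]
    ring
  have hm1 := memLp_crossStat (C := C) hkl α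
  have hm2 := memLp_crossStat (C := C) hkl.symm β
  have hCS := sq_integral_mul_le (hm1.add hm2) hr
  simp only [Pi.add_apply, add_mul] at hCS
  have i1 : Integrable (fun s => crossStat C k l (scale α) s * r s) (sourceLaw C) :=
    hm1.integrable_mul hr
  have i2 : Integrable (fun s => crossStat C l k (scale β) s * r s) (sourceLaw C) :=
    hm2.integrable_mul hr
  rw [integral_add i1 i2, hα, hβ,
    integral_sq_crossStat_add hT hC hkl, hquad] at hCS
  rw [e1, e2]
  have h3 : (T : ℝ) * (1 / T * α m) = α m := by field_simp
  rw [h3]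
  calc _ = (-α m + β m * w) ^ 2 := by ring
    _ ≤ _ := hCS

end Estimators

/-! ### From the Cauchy-Schwarz inequality to the bounds on the ISR. -/

section Bounds

variable {K M T : ℕ} {C : Fin K → Matrix (Fin M × Fin T) (Fin M × Fin T) ℝ}
  {Bhat : Data K M T → Fin M → Matrix (Fin K) (Fin K) ℝ}
  {A : Fin M → Matrix (Fin K) (Fin K) ℝ} {k l : Fin K} {m : Fin M}

/-- Either the ISR is infinite, or the relative coefficient is square integrable. -/
lemma ISR_eq_top_or (hT : 0 < T) (hC : ∀ k, (C k).PosDef)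
    (hB : ∀ n i j, Measurable fun X => Bhat X n i j) :
    ISR C A Bhat k l m = ⊤ ∨
      MemLp (fun s => relCoef (Bhat (mix A s) m) (A m) k l) 2 (sourceLaw C) ∧
      ISR C A Bhat k l m = ENNReal.ofReal
        (∫ s, relCoef (Bhat (mix A s) m) (A m) k l ^ 2 ∂(sourceLaw C)) *
        ENNReal.ofReal ((block (C l) m m).trace / (block (C k) m m).trace) := by
  have hrm := measurable_relCoef (A := A) hB k l m
  have hsq : ∀ s : Fin K → SCV M T,
      |(Bhat (mix A s) m * A m) k l| ^ 2 / |(Bhat (mix A s) m * A m) k k| ^ 2 =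
      relCoef (Bhat (mix A s) m) (A m) k l ^ 2 := fun s => by
    rw [sq_abs, sq_abs, relCoef, div_pow]
  have hpos : 0 < (block (C l) m m).trace / (block (C k) m m).trace :=
    div_pos (trace_block_pos hT hC l m) (trace_block_pos hT hC k m)
  unfold ISR
  simp_rw [hsq, energy_eq_trace hC]
  by_cases hint : Integrable (fun s => relCoef (Bhat (mix A s) m) (A m) k l ^ 2) (sourceLaw C)
  · right
    refine ⟨(memLp_two_iff_integrable_sq hrm.aestronglyMeasurable).2 hint, ?_⟩
    rw [ofReal_integral_eq_lintegral_ofReal hint (.of_forall fun s => sq_nonneg _)]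
  · left
    have : ∫⁻ s, ENNReal.ofReal (relCoef (Bhat (mix A s) m) (A m) k l ^ 2) ∂(sourceLaw C) = ⊤ := by
      by_contra h
      refine hint ⟨(hrm.pow_const 2).aestronglyMeasurable, ?_⟩
      rw [hasFiniteIntegral_iff_ofReal (.of_forall fun s => sq_nonneg _)]
      exact lt_top_iff_ne_top.2 h
    rw [this, ENNReal.top_mul (ENNReal.ofReal_pos.2 hpos).ne']

/-- Expanding `(b + c v)² ≤ b v` and dropping `c² v²` gives `b² ≤ b (1 - 2 c) v`; divide by `b` when
it is positive. The unbiased case uses `c = 0`. -/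
lemma le_of_sq_le_mul {T b c v : ℝ} (hT : 0 < T) (hv : 0 ≤ v)
    (h : (T * b + T * c * v) ^ 2 ≤ T * (T * b) * v) : b ≤ (1 + 2 * max 0 (-c)) * v := by
  have h' : (b + c * v) ^ 2 ≤ b * v := by
    refine le_of_mul_le_mul_left (a := T ^ 2) ?_ (by positivity)
    calc T ^ 2 * (b + c * v) ^ 2 = (T * b + T * c * v) ^ 2 := by ring
      _ ≤ _ := h
      _ = _ := by ring
  have hmax : 0 ≤ max 0 (-c) := le_max_left _ _
  rcases le_or_gt b 0 with hb | hb
  · exact hb.trans (by positivity)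
  · have h1 : b * b ≤ b * ((1 - 2 * c) * v) := by nlinarith [sq_nonneg (c * v)]
    have h2 := le_of_mul_le_mul_left h1 hb
    refine h2.trans (mul_le_mul_of_nonneg_right ?_ hv)
    linarith [le_max_right 0 (-c)]

theorem iCRLB_le_of_locallyUnbiased (hT : 0 < T) (hC : ∀ k, (C k).PosDef) (hkl : k ≠ l)
    (hG : IsUnit (kappa C k l - (kappa C l k)⁻¹)) (hA : ∀ n, IsUnit (A n))
    (hB : ∀ n i j, Measurable fun X => Bhat X n i j) (hU : LocallyUnbiased C Bhat k l m A) :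
    ENNReal.ofReal (iCRLB C k l m) ≤ ISR C A Bhat k l m := by
  rcases ISR_eq_top_or (A := A) (k := k) (l := l) (m := m) hT hC hB with h | ⟨hL2, h⟩
  · rw [h]; exact le_top
  have hT' : (0 : ℝ) < T := by exact_mod_cast hT
  have hv : 0 ≤ ∫ s, relCoef (Bhat (mix A s) m) (A m) k l ^ 2 ∂(sourceLaw C) :=
    integral_nonneg fun s => sq_nonneg _
  have key := sq_le_of_integral_crossStat_mul hT hC hkl m hG hL2 (w := 0)
    (fun α => (hU.integral_crossStat_mul hC hB hA hL2 hkl α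
      (relCoef_transvection hkl)).trans (by ring))
    (fun β => hU.integral_crossStat_mul hC hB hA hL2 hkl.symm β (relCoef_transvection_swap hkl))
  rw [mul_zero] at key
  have hle : 1 / (T : ℝ) * (Pi.single m 1 ⬝ᵥ
      (kappa C k l - (kappa C l k)⁻¹)⁻¹ *ᵥ Pi.single m 1) ≤ (1 + 2 * max 0 (-0)) *
      ∫ s, relCoef (Bhat (mix A s) m) (A m) k l ^ 2 ∂(sourceLaw C) :=
    le_of_sq_le_mul hT' hv (by rwa [mul_zero (T : ℝ), zero_mul])
  rw [neg_zero, max_self, mul_zero, add_zero, one_mul] at hle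
  have hpos : 0 < (block (C l) m m).trace / (block (C k) m m).trace :=
    div_pos (trace_block_pos hT hC l m) (trace_block_pos hT hC k m)
  rw [h, ← ENNReal.ofReal_mul hv]
  exact ENNReal.ofReal_le_ofReal (mul_le_mul_of_nonneg_right hle hpos.le)

theorem iCRLB_le_of_equivariant (hT : 0 < T) (hC : ∀ k, (C k).PosDef) (hkl : k ≠ l)
    (hG : IsUnit (kappa C k l - (kappa C l k)⁻¹)) (hA : ∀ n, IsUnit (A n))
    (hB : ∀ n i j, Measurable fun X => Bhat X n i j)
    (hne : ∀ᵐ s ∂(sourceLaw C), (Bhat (mix A s) m * A m) k k ≠ 0) (hE : Equivariant Bhat) :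
    ENNReal.ofReal (iCRLB C k l m) ≤
      ENNReal.ofReal (1 + 2 * max 0 (-crossTerm C k l m)) * ISR C A Bhat k l m := by
  have hmax : 0 < 1 + 2 * max 0 (-crossTerm C k l m) := by
    have : 0 ≤ max 0 (-crossTerm C k l m) := le_max_left _ _
    positivity
  rcases ISR_eq_top_or (A := A) (k := k) (l := l) (m := m) hT hC hB with h | ⟨hL2, h⟩
  · rw [h, ENNReal.mul_top (ENNReal.ofReal_pos.2 hmax).ne']; exact le_top
  have hT' : (0 : ℝ) < T := by exact_mod_cast hT
  have hv : 0 ≤ ∫ s, relCoef (Bhat (mix A s) m) (A m) k l ^ 2 ∂(sourceLaw C) :=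
    integral_nonneg fun s => sq_nonneg _
  have key := sq_le_of_integral_crossStat_mul hT hC hkl m hG hL2
    (hE.integral_crossStat_mul hC hB hA hkl hne hL2)
    (hE.integral_crossStat_swap_mul hC hB hA hkl hne hL2)
  have hle := le_of_sq_le_mul hT' hv key
  have hpos : 0 < (block (C l) m m).trace / (block (C k) m m).trace :=
    div_pos (trace_block_pos hT hC l m) (trace_block_pos hT hC k m)
  rw [h, ← ENNReal.ofReal_mul hv, ← ENNReal.ofReal_mul hmax.le, ← mul_assoc]
  exact ENNReal.ofReal_le_ofReal (mul_le_mul_of_nonneg_right hle hpos.le)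

end Bounds

end IVA

theorem mainTheorem2 {K M T : ℕ} (hT : 0 < T)
    (C : Fin K → Matrix (Fin M × Fin T) (Fin M × Fin T) ℝ) (hC : ∀ k, (C k).PosDef) :
    -- the Gaussian density, and the score
    (∀ k, multivariateGaussian 0 (C k) =
      volume.withDensity (fun x => ENNReal.ofReal (IVA.density (C k) x))) ∧
    (∀ k m (x : IVA.SCV M T), IVA.score (C k) m x =
      ∑ p, (fun t => x (p, t)) ᵥ* IVA.block (C k)⁻¹ p m) ∧
    -- the score covariance blocks
    (∀ k m n t u, Integrable
      (fun x => IVA.score (C k) m x t * IVA.score (C k) n x u) (multivariateGaussian 0 (C k))) ∧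
    (∀ k m n, IVA.scoreCov (C k) m n = IVA.block (C k)⁻¹ m n) ∧
    -- the matrices `𝒦_{kl}`
    (∀ k l m n, IVA.kappa C k l m n =
      (1 / (T : ℝ)) * (IVA.block (C k)⁻¹ n m * IVA.block (C l) m n).trace) ∧
    (∀ k l, (IVA.kappa C k l).PosDef) ∧
    -- the induced Cramér-Rao lower bound on the ISR
    (∀ (k l : Fin K) (m : Fin M), k ≠ l →
      IsUnit (IVA.kappa C k l - (IVA.kappa C l k)⁻¹) →
      ∀ A : Fin M → Matrix (Fin K) (Fin K) ℝ, (∀ n, IsUnit (A n)) →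
      ∀ Bhat : IVA.Data K M T → Fin M → Matrix (Fin K) (Fin K) ℝ,
        (∀ n i j, Measurable fun X => Bhat X n i j) →
        (∀ᵐ s ∂(IVA.sourceLaw C), (Bhat (IVA.mix A s) m * A m) k k ≠ 0) →
        -- every locally unbiased estimator obeys the bound
        (IVA.LocallyUnbiased C Bhat k l m A →
          ENNReal.ofReal (IVA.iCRLB C k l m) ≤ IVA.ISR C A Bhat k l m) ∧
        -- every equivariant estimator obeys it up to a factor `1 + O(1/T)`, which is `1` if the
        -- cross term is nonnegative
        (IVA.Equivariant Bhat →
          ENNReal.ofReal (IVA.iCRLB C k l m) ≤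
            ENNReal.ofReal (1 + 2 * max 0 (-IVA.crossTerm C k l m)) *
              IVA.ISR C A Bhat k l m)) := by
  exact ⟨fun k => IVA.multivariateGaussian_eq_withDensity (hC k),
    fun k m x => IVA.score_eq_sum_vecMul (hC k) m x,
    fun k m n t u => IVA.integrable_score_mul_score (hC k) m n t u,
    fun k m n => IVA.scoreCov_eq_block (hC k) m n,
    fun k l m n => IVA.kappa_eq_trace hC k l m n,
    fun k l => IVA.posDef_kappa hT hC k l,
    fun k l m hkl hG A hA Bhat hB hne =>
      ⟨fun hU => IVA.iCRLB_le_of_locallyUnbiased hT hC hkl hG hA hB hU,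
        fun hE => IVA.iCRLB_le_of_equivariant hT hC hkl hG hA hB hne hE⟩⟩
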